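/- Let $M=(U,\mathcal I)$ be a matroid on a finite ground set with $n=|U|$ elements and rank $r\ge 1$, and let $f:2^U\to\mathbb R$ be normalized ($f(\emptyset)=0$), monotone and submodular, with curvature $c\in[0,1]$, i.e. $f(A\cup\{x\})-f(A)\ge(1-c)f(\{x\})$ for all $A\subseteq U$ and $x\notin A$. Let $0<\epsilon\le 1$ and $\alpha>0$, and put $\rho(t)=(1-e^{-t})/t$ for $t\neq 0$ and $\rho(0)=1$. $M$ and $f$ are given by a membership oracle for $\mathcal I$ and a value oracle for $f$; $U$ (as a list in an arbitrary order) and $r$ are known to the algorithms. *Potential and sampling.* For $c'\in(0,1]$ and $0\le b\le a$ let $m_{a,b}=\int_0^1\frac{c'e^{c'p}}{e^{c'}-1}p^b(1-p)^{a-b}\,dp$, and let $m_{a,b}=0$ if $a$ or $b$ is negative. For $\emptyset\ne A\subseteq U$ let $\tau(A)=\sum_{B\subseteq A}m_{|A|-1,|B|-1}$ and let $\nu_A$ be the probability distribution on subsets of $A$ with $\nu_A(B)=m_{|A|-1,|B|-1}/\tau(A)$. An evaluation of $\tilde g(A)$ with $N$ samples draws fresh independent $B_1,\dots,B_N\sim\nu_A$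 and returns $\tau(A)\frac1N\sum_{i=1}^N f(B_i)$. *Algorithm 2* (inputs $c',\epsilon',\alpha$). With $H_k=\sum_{t=1}^k 1/t$, set $\epsilon_2=\frac{\epsilon'}{4rH_r}$, $I=\left\lceil\left(\frac{1+\epsilon_2}{1-\epsilon_2}(2+3r\epsilon_2)-1\right)\epsilon_2^{-1}\right\rceil$ and $N=\left\lceil\frac12\left(\frac{c'e^{c'}}{e^{c'}-1}\cdot\frac{H_n}{\epsilon_2}\right)^2\ln\left((I+1)rn^{1+\alpha}\right)\right\rceil$. Every evaluation of $\tilde g$ uses $N$ fresh samples. Build $S$ greedily from $\emptyset$: $r$ times, add an element $x\notin S$ with $S\cup\{x\}\in\mathcal I$ maximizing the evaluated $\tilde g(S\cup\{x\})$. Evaluate $v=\tilde g(S)$. Then perform at most $I$ iterations of the following: go through the pairs $e\in S$, $x\in U\setminus S$; if $S'=(S\setminus\{e\})\cup\{x\}\in\mathcal I$, evaluate $v'=\tilde g(S')$; at the first pair with $v'>(1+\epsilon_2)v$ replace $(S,v)$ by $(S',v')$ and end the iteration. If an iteration finds no such pair, return $S$; if all $I$ iterations make a replacement, return an error. *Unknown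 curvature algorithm* (inputs $\epsilon,\alpha$, but not $c$). For each $c'\in\{k\epsilon:1\le k\le\lfloor\epsilon^{-1}\rfloor\}\cup\{1\}$ run Algorithm 2 with curvature parameter $c'$, error parameter $\epsilon/2$ and confidence parameter $\alpha$, and output, among the solutions returned (errors are ignored), one with the largest value of $f$. Time is the number of oracle calls (to the value oracle and to the membership oracle) plus the number of random sets drawn. **Theorem.** There are absolute constants $K,D,d$ such that for all such $M,f,c,\epsilon,\alpha$: 1. every run of the unknown curvature algorithm takes time at most $K\,r^4n\epsilon^{-4}\max(\alpha,1)\,\ln^d(2n/\epsilon)$; in particular the time is $\tilde O(r^4n\epsilon^{-4}\alpha)$ for $\alpha\ge1$; 2. with probability at least $1-D\,n^{-\alpha}$ the algorithm outputs a set $S\in\mathcal I$ with $f(S)\ge(\rho(c)-\epsilon)f(O)$ for every $O\in\mathcal I$. -/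

import Mathlib

namespace NonObliviousSearch

universe u v w

/-! ### Set functions, curvature, approximate solutions -/

/-- `f(A ∪ B) + f(A ∩ B) ≤ f(A) + f(B)` for all sets `A`, `B`. -/
def IsSubmodular {U : Type u} [DecidableEq U] (f : Finset U → ℝ) : Prop :=
  ∀ A B : Finset U, f (A ∪ B) + f (A ∩ B) ≤ f A + f B

/-- `f` has curvature `c`: the marginal value `f(A + x) - f(A)` of an element `x ∉ A` is at least
`(1 - c) f({x})`. -/
def HasCurvature {U : Type u} [DecidableEq U] (f : Finset U → ℝ) (c : ℝ) : Prop :=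
  ∀ (A : Finset U) (x : U), x ∉ A → (1 - c) * f {x} ≤ f (insert x A) - f A

/-- `S` is independent and its value is at least `q` times that of every independent set. -/
def IsApproxSolution {U : Type u} (M : Matroid U) (f : Finset U → ℝ) (q : ℝ) (S : Finset U) :
    Prop :=
  M.Indep (S : Set U) ∧ ∀ O : Finset U, M.Indep (O : Set U) → q * f O ≤ f S

/-- The ratio `ρ(c) = (1 - e^{-c}) / c`, extended continuously by `ρ(0) = 1`. -/
noncomputable def rho (c : ℝ) : ℝ :=
  if c = 0 then 1 else (1 - Real.exp (-c)) / c

/-! ### Randomized oracle programs -/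

/-- Randomized programs which access the objective function and the independent sets of a matroid
on `U` only through oracles. Three operations are available: asking for the value of a set, asking
whether a set is independent, and drawing a fresh random set from a given distribution. -/
inductive OracleProg (U : Type u) (β : Type v) : Type (max u v)
  | ret (b : β) : OracleProg U β
  | value (A : Finset U) (k : ℝ → OracleProg U β) : OracleProg U β
  | indep (A : Finset U) (k : Bool → OracleProg U β) : OracleProg U β
  | draw (μ : PMF (Finset U)) (k : Finset U → OracleProg U β) : OracleProg U β

namespace OracleProg

/-- Sequential composition. -/
def bind {U : Type u} {β : Type v} {γ : Type w} :
    OracleProg U β → (β → OracleProg U γ) → OracleProg U γ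
  | ret b, q => q b
  | value A k, q => value A fun y => (k y).bind q
  | indep A k, q => indep A fun b => (k b).bind q
  | draw μ k, q => draw μ fun B => (k B).bind q

open Classical in
/-- The joint law of the output and of the running time when the program is run on the instance
`(M, f)`. Each oracle call and each random draw costs one unit of time; different draws are
independent. -/
noncomputable def run {U : Type u} {β : Type v} (M : Matroid U) (f : Finset U → ℝ) :
    OracleProg U β → PMF (β × ℕ)
  | ret b => PMF.pure (b, 0)
  | value A k => ((k (f A)).run M f).map fun z => (z.1, z.2 + 1)
  | indep A k => ((k (decide (M.Indep (A : Set U)))).run M f).map fun z => (z.1, z.2 + 1)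
  | draw μ k => (μ.bind fun B => (k B).run M f).map fun z => (z.1, z.2 + 1)

end OracleProg

/-! ### The potential function and its estimator -/

/-- The coefficient `m_{a,b} = ∫₀¹ (c e^{cp} / (e^c - 1)) p^b (1 - p)^{a - b} dp`, `0 ≤ b ≤ a`. -/
noncomputable def mcoeff (c : ℝ) (a b : ℕ) : ℝ :=
  ∫ p in (0 : ℝ)..1, c * Real.exp (c * p) / (Real.exp c - 1) * (p ^ b * (1 - p) ^ (a - b))

/-- The weight `m_{|A| - 1, |B| - 1}` of a set `B ⊆ A`; it is `0` for `B = ∅`, by the convention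
that coefficients with a negative index vanish. -/
noncomputable def weight {U : Type u} (c : ℝ) (A B : Finset U) : ℝ :=
  if B.card = 0 then 0 else mcoeff c (A.card - 1) (B.card - 1)

/-- `τ(A) = ∑_{B ⊆ A} m_{|A| - 1, |B| - 1}`. -/
noncomputable def tau {U : Type u} (c : ℝ) (A : Finset U) : ℝ :=
  ∑ B ∈ A.powerset, weight c A B

/-- The weights as a function on all finite sets, `0` off the subsets of `A`. -/
noncomputable def weightFun {U : Type u} (c : ℝ) (A B : Finset U) : ENNReal :=
  open Classical in if B ⊆ A then ENNReal.ofReal (weight c A B) else 0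

open Classical in
/-- The distribution `ν_A` on the subsets of `A`, with `ν_A(B) = m_{|A| - 1, |B| - 1} / τ(A)`.
The second branch is only there for the degenerate case `A = ∅`, where all weights vanish. -/
noncomputable def nu {U : Type u} (c : ℝ) (A : Finset U) : PMF (Finset U) :=
  if h : (∑' B, weightFun c A B) ≠ 0 ∧ (∑' B, weightFun c A B) ≠ ⊤ then
    PMF.normalize (weightFun c A) h.1 h.2
  else PMF.pure ∅

/-- The sum of the values of `N` independent random sets with law `μ`. -/
noncomputable def sumSamples {U : Type u} (μ : PMF (Finset U)) : ℕ → OracleProg U ℝ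
  | 0 => .ret 0
  | N + 1 => .draw μ fun B => .value B fun y => (sumSamples μ N).bind fun s => .ret (y + s)

/-- The estimate `τ(A) (1/N) ∑ᵢ f(Bᵢ)` of the potential of `A` from `N` fresh independent samples
`Bᵢ` of `ν_A`. -/
noncomputable def estimate {U : Type u} (c : ℝ) (N : ℕ) (A : Finset U) : OracleProg U ℝ :=
  (sumSamples (nu c A) N).bind fun s => .ret (tau c A * (1 / (N : ℝ)) * s)

/-! ### The two phases of the local search algorithm -/

/-- One round of the greedy algorithm: among the listed `x ∉ S` with `S + x` independent find one
maximizing the estimated value of `S + x` (the argument `best` is the best one so far). -/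
noncomputable def greedyRound {U : Type u} [DecidableEq U] (est : Finset U → OracleProg U ℝ)
    (S : Finset U) : List U → Option (U × ℝ) → OracleProg U (Option (U × ℝ))
  | [], best => .ret best
  | x :: xs, best =>
    if x ∈ S then greedyRound est S xs best
    else .indep (insert x S) fun b =>
      if b then (est (insert x S)).bind fun y =>
        greedyRound est S xs
          (match best with
            | none => some (x, y)
            | some (x', y') => if y' < y then some (x, y) else some (x', y'))
      else greedyRound est S xs best

/-- The given number of further rounds of the greedy algorithm, from `S`. -/
noncomputable def greedy {U : Type u} [DecidableEq U] (est : Finset U → OracleProg U ℝ)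
    (elems : List U) : ℕ → Finset U → OracleProg U (Finset U)
  | 0, S => .ret S
  | k + 1, S => (greedyRound est S elems none).bind fun o =>
      match o with
      | none => .ret S
      | some (x, _) => greedy est elems k (insert x S)

/-- Go through the listed pairs `(e, x)` until an independent exchange `S' = S - e + x` is found
whose estimated value `v'` satisfies `v' > (1 + δ) v`; return `S'` and `v'`, if there is one. -/
noncomputable def findExchange {U : Type u} [DecidableEq U] (est : Finset U → OracleProg U ℝ)
    (δ : ℝ) (S : Finset U) (v : ℝ) : List (U × U) → OracleProg U (Option (Finset U × ℝ))
  | [] => .ret none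
  | (e, x) :: ps => .indep (insert x (S.erase e)) fun b =>
      if b then (est (insert x (S.erase e))).bind fun v' =>
        if (1 + δ) * v < v' then .ret (some (insert x (S.erase e), v'))
        else findExchange est δ S v ps
      else findExchange est δ S v ps

/-- At most the given number of local search iterations, from the solution `S` with stored
estimate `v`. An iteration without an improvement returns the current solution; if all iterations
make an improvement, the result is an error (`none`). -/
noncomputable def localSearch {U : Type u} [DecidableEq U] (est : Finset U → OracleProg U ℝ)
    (elems : List U) (δ : ℝ) : ℕ → Finset U → ℝ → OracleProg U (Option (Finset U))
  | 0, _, _ => .ret none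
  | k + 1, S, v =>
      (findExchange est δ S v
        ((elems.filter fun e => decide (e ∈ S)) ×ˢ (elems.filter fun x => decide (x ∉ S)))).bind
      fun o =>
        match o with
        | none => .ret (some S)
        | some (S', v') => localSearch est elems δ k S' v'

/-- The step parameter `ε₂ = ε / (4 r H_r)`. -/
noncomputable def stepParam (r : ℕ) (ε : ℝ) : ℝ :=
  ε / (4 * (r : ℝ) * (harmonic r : ℝ))

/-- The maximal number of local search iterations,
`I = (((1 + ε₂) / (1 - ε₂)) (2 + 3 r ε₂) - 1) / ε₂`, rounded up. -/
noncomputable def iterations (r : ℕ) (ε : ℝ) : ℕ :=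
  ⌈((1 + stepParam r ε) / (1 - stepParam r ε) * (2 + 3 * (r : ℝ) * stepParam r ε) - 1) *
    (stepParam r ε)⁻¹⌉₊

/-- The number of samples for an evaluation of the potential,
`N = ½ ((c e^c / (e^c - 1)) (H_n / ε₂))² ln((I + 1) r n^{1 + α})`, rounded up. -/
noncomputable def samples (n r : ℕ) (c ε α : ℝ) : ℕ :=
  ⌈1 / 2 * (c * Real.exp c / (Real.exp c - 1) * ((harmonic n : ℝ) / stepParam r ε)) ^ 2 *
    Real.log (((iterations r ε : ℝ) + 1) * (r : ℝ) * (n : ℝ) ^ (1 + α))⌉₊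

/-- The randomized non-oblivious local search algorithm, for a matroid of rank `r` with ground set
listed by `elems`, with curvature parameter `c`, error parameter `ε` and confidence parameter `α`.
The result `none` is an error. -/
noncomputable def localSearchAlg {U : Type u} [DecidableEq U] (elems : List U) (r : ℕ)
    (c ε α : ℝ) : OracleProg U (Option (Finset U)) :=
  (greedy (estimate c (samples elems.length r c ε α)) elems r ∅).bind fun S₀ =>
  (estimate c (samples elems.length r c ε α) S₀).bind fun v₀ =>
  localSearch (estimate c (samples elems.length r c ε α)) elems (stepParam r ε)
    (iterations r ε) S₀ v₀

/-! ### Unknown curvature -/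

/-- The set of guesses `{kε : 1 ≤ k ≤ ⌊ε⁻¹⌋} ∪ {1}`. -/
noncomputable def guesses (ε : ℝ) : Finset ℝ :=
  ((Finset.Icc 1 ⌊ε⁻¹⌋₊).image fun k : ℕ => (k : ℝ) * ε) ∪ {1}

/-- Run the local search algorithm with error parameter `ε / 2` for each of the listed curvature
parameters and return the solution of largest value; runs that end in an error are ignored, and
the result is an error if all of them do. The argument `best` is the best solution so far. -/
noncomputable def tryGuesses {U : Type u} [DecidableEq U] (elems : List U) (r : ℕ) (ε α : ℝ) :
    List ℝ → Option (Finset U × ℝ) → OracleProg U (Option (Finset U))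
  | [], best => .ret (best.map Prod.fst)
  | c :: cs, best => (localSearchAlg elems r c (ε / 2) α).bind fun o =>
      match o with
      | none => tryGuesses elems r ε α cs best
      | some S => .value S fun y =>
          tryGuesses elems r ε α cs
            (match best with
              | none => some (S, y)
              | some (S', y') => if y' < y then some (S, y) else some (S', y'))

/-- The unknown curvature algorithm; the curvature of the objective function is not an input. -/
noncomputable def unknownCurvatureAlg {U : Type u} [DecidableEq U] (elems : List U) (r : ℕ)
    (ε α : ℝ) : OracleProg U (Option (Finset U)) :=
  tryGuesses elems r ε α ((guesses ε).sort (· ≤ ·)) none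

end NonObliviousSearch

open NonObliviousSearch

/-! The search follows a potential `g` instead of `f`. By `potential_insert_sub` a marginal of `g`
at `A` is the marginal of `f` at a random subset of `A` that keeps each element with probability
`p`, averaged over `p` with the density proportional to `e^{cp}`. Hence `g` is monotone and
submodular whenever `f` is, `f ≤ g` (`le_potential`), and `g(A) ≤ τ(A) f(A)` with `τ(A) ≤ D H_{|A|}`
(`tau_le`), where `D = density c 1 = 1/ρ(c)`.

The core is `sum_potential_sub_le`. Take bases `S`, `O` with a bijection `π : O → S` such that every
`S - π(o) + o` is independent (`exists_exchange_bijOn`, by Hall's theorem). The losses of `g` under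
these exchanges sum to at most `D f(S) - f(O)`. With `F` the multilinear extension of `f` on `S`,
the removals contribute `∫ density · F'`, which is `D f(S) - c ∫ density · F` by parts because
`density' = c · density`. By submodularity and curvature, the additions gain at least `f(O) - c ∫
density · F`, and the integrals cancel. At an approximate local optimum each exchange loses at least
`-4 ε₂ g(S)`, and `ε₂` is chosen so that all of them together cost `ε D f(S)`
(`IsLocalOptimum.isApproxSolution`).

Sampling enters through Hoeffding's inequality: `f` lies in `[0, f(A)]` on the subsets of `A` and
`f(A) ≤ g(A)`, so `N` samples give a relative error `ε₂` (`failProb_estimate_le`). If the estimates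
are accurate, greedy ends with `g(A) ≤ (2 + 3 r ε₂) g(S)` for every independent `A`, and since each
replacement raises the stored value by a factor above `1 + ε₂`, `I` replacements are impossible.
Each evaluation uses fresh samples, so a union bound along the run (`failProb_bind_le`) suffices
although the evaluated sets depend on earlier samples.

For unknown curvature, some guess `c'` lies in `[c, c + ε]`. It is a valid curvature, `ρ(c') ≥ ρ(c)
- ε/2` (`rho_le_add`), and only the run for `c'` has to succeed, since the other runs return
independent sets or errors with certainty. The running time is a worst case bound, carried by the
predicate `Runs`. -/

namespace NonObliviousSearch

universe u v w

/-! ### Expectations, failure probabilities and worst case behaviour of programs -/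

namespace OracleProg

open scoped ENNReal

variable {U : Type u} {β : Type v} {γ : Type w}

open Classical in
/-- The expectation of `h` under the law of the output of the program. -/
noncomputable def expect (M : Matroid U) (f : Finset U → ℝ) :
    OracleProg U β → (β → ℝ≥0∞) → ℝ≥0∞
  | ret b, h => h b
  | value A k, h => expect M f (k (f A)) h
  | indep A k, h => expect M f (k (decide (M.Indep (A : Set U)))) h
  | draw μ k, h => ∑' B, μ B * expect M f (k B) h

theorem expect_bind (M : Matroid U) (f : Finset U → ℝ) (p : OracleProg U β)
    (q : β → OracleProg U γ) (h : γ → ℝ≥0∞) :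
    expect M f (p.bind q) h = expect M f p fun b => expect M f (q b) h := by
  induction p with
  | ret b => rfl
  | value A k ih => simp only [bind, expect, ih]
  | indep A k ih => simp only [bind, expect, ih]
  | draw μ k ih => simp only [bind, expect, ih]

theorem expect_mono (M : Matroid U) (f : Finset U → ℝ) (p : OracleProg U β)
    {h h' : β → ℝ≥0∞} (hh : ∀ b, h b ≤ h' b) : expect M f p h ≤ expect M f p h' := by
  induction p with
  | ret b => exact hh b
  | value A k ih => exact ih _
  | indep A k ih => exact ih _
  | draw μ k ih => exact ENNReal.tsum_le_tsum fun B => mul_le_mul_right (ih B) _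

theorem expect_add (M : Matroid U) (f : Finset U → ℝ) (p : OracleProg U β)
    (h h' : β → ℝ≥0∞) :
    expect M f p (fun b => h b + h' b) = expect M f p h + expect M f p h' := by
  induction p with
  | ret b => rfl
  | value A k ih => exact ih _
  | indep A k ih => exact ih _
  | draw μ k ih => simp only [expect, ih, mul_add, ENNReal.tsum_add]

theorem expect_const (M : Matroid U) (f : Finset U → ℝ) (p : OracleProg U β) (a : ℝ≥0∞) :
    expect M f p (fun _ => a) = a := by
  induction p with
  | ret b => rfl
  | value A k ih => exact ih _
  | indep A k ih => exact ih _
  | draw μ k ih => simp only [expect, ih, ENNReal.tsum_mul_right, μ.tsum_coe, one_mul]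

theorem expect_mul_const (M : Matroid U) (f : Finset U → ℝ) (p : OracleProg U β)
    (h : β → ℝ≥0∞) (a : ℝ≥0∞) :
    expect M f p (fun b => h b * a) = expect M f p h * a := by
  induction p with
  | ret b => rfl
  | value A k ih => exact ih _
  | indep A k ih => exact ih _
  | draw μ k ih => simp only [expect, ih, ← mul_assoc, ENNReal.tsum_mul_right]

/-- Incrementing the clock is injective and leaves the output alone, so the time component sums out.
Probabilities can then be computed by structural recursion through `expect`. -/
theorem tsum_run_mul (M : Matroid U) (f : Finset U → ℝ) (p : OracleProg U β) (h : β → ℝ≥0∞) :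
    ∑' z, p.run M f z * h z.1 = expect M f p h := by
  have key : ∀ (μ : PMF (β × ℕ)),
      ∑' z, (μ.map fun z => (z.1, z.2 + 1)) z * h z.1 = ∑' z, μ z * h z.1 := by
    intro μ
    simp only [PMF.map_apply, ← ENNReal.tsum_mul_right]
    rw [ENNReal.tsum_comm]
    refine tsum_congr fun w => ?_
    rw [tsum_eq_single (w.1, w.2 + 1)]
    · simp
    · intro z hz
      rw [if_neg hz, zero_mul]
  induction p with
  | ret b =>
    simp only [run, expect]
    rw [tsum_eq_single (b, 0)]
    · simp
    · intro z hz
      simp [PMF.pure_apply, hz]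
  | value A k ih => rw [run, key, ih]; rfl
  | indep A k ih => rw [run, key, ih]; rfl
  | draw μ k ih =>
    rw [run, key]
    simp only [PMF.bind_apply, ← ENNReal.tsum_mul_right, expect]
    rw [ENNReal.tsum_comm]
    refine tsum_congr fun B => ?_
    rw [← ih B, ← ENNReal.tsum_mul_left]
    simp only [mul_assoc]

open Classical in
/-- The probability that the output of the program violates `P`. -/
noncomputable def failProb (M : Matroid U) (f : Finset U → ℝ) (p : OracleProg U β)
    (P : β → Prop) : ℝ≥0∞ :=
  expect M f p fun b => if P b then 0 else 1

theorem failProb_ret (M : Matroid U) (f : Finset U → ℝ) {b : β} {P : β → Prop} (hb : P b)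
    (a : ℝ≥0∞) : failProb M f (ret b : OracleProg U β) P ≤ a := by
  simp [failProb, expect, hb]

theorem failProb_mono (M : Matroid U) (f : Finset U → ℝ) (p : OracleProg U β)
    {P Q : β → Prop} (h : ∀ b, P b → Q b) : failProb M f p Q ≤ failProb M f p P := by
  refine expect_mono M f p fun b => ?_
  by_cases hP : P b
  · simp [hP, h b hP]
  · rw [if_neg hP]
    split_ifs <;> simp

/-- The union bound for sequential composition. -/
theorem failProb_bind_le (M : Matroid U) (f : Finset U → ℝ) {p : OracleProg U β}
    {q : β → OracleProg U γ} {Q : β → Prop} {P : γ → Prop} {a b : ℝ≥0∞}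
    (hp : failProb M f p Q ≤ a) (hq : ∀ x, Q x → failProb M f (q x) P ≤ b) :
    failProb M f (p.bind q) P ≤ a + b := by
  classical
  rw [failProb, expect_bind]
  refine le_trans ?_ (add_le_add_left hp b)
  rw [failProb, ← expect_const M f p b, ← expect_add]
  refine expect_mono M f p fun x => ?_
  by_cases hx : Q x
  · rw [if_pos hx, zero_add]
    exact hq x hx
  · rw [if_neg hx]
    refine le_trans ?_ le_self_add
    refine le_trans (expect_mono M f (q x) (h' := fun _ => 1) fun y => ?_) (expect_const _ _ _ _).le
    split_ifs <;> simp

theorem run_toOuterMeasure_toReal (M : Matroid U) (f : Finset U → ℝ) (p : OracleProg U β)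
    {P : β → Prop} {a : ℝ} (ha : 0 ≤ a) (h : failProb M f p P ≤ ENNReal.ofReal a) :
    1 - a ≤ ((p.run M f).toOuterMeasure {z | P z.1}).toReal := by
  classical
  have h1 : (p.run M f).toOuterMeasure {z | P z.1} + failProb M f p P = 1 := by
    rw [failProb, ← tsum_run_mul, PMF.toOuterMeasure_apply, ← ENNReal.tsum_add,
      ← (p.run M f).tsum_coe]
    refine tsum_congr fun z => ?_
    by_cases hz : P z.1 <;> simp [Set.indicator, hz]
  have h2 : (p.run M f).toOuterMeasure {z | P z.1} ≠ ⊤ := by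
    intro h; rw [h] at h1; simp at h1
  have h3 : (1 : ℝ≥0∞) ≤ (p.run M f).toOuterMeasure {z | P z.1} + ENNReal.ofReal a := by
    rw [← h1]; gcongr
  have h4 := ENNReal.toReal_mono (by finiteness) h3
  rw [ENNReal.toReal_add h2 (by finiteness), ENNReal.toReal_ofReal ha, ENNReal.toReal_one] at h4
  linarith

open Classical in
/-- Every run of the program takes time at most `t` and its output satisfies `P`. -/
def Runs (M : Matroid U) (f : Finset U → ℝ) (P : β → Prop) : OracleProg U β → ℕ → Prop
  | ret b, _ => P b
  | value A k, t => ∃ s, s + 1 ≤ t ∧ Runs M f P (k (f A)) s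
  | indep A k, t => ∃ s, s + 1 ≤ t ∧ Runs M f P (k (decide (M.Indep (A : Set U)))) s
  | draw _ k, t => ∃ s, s + 1 ≤ t ∧ ∀ B, Runs M f P (k B) s

theorem Runs.mono {M : Matroid U} {f : Finset U → ℝ} {P : β → Prop} {p : OracleProg U β}
    {s t : ℕ} (h : Runs M f P p s) (hst : s ≤ t) : Runs M f P p t := by
  cases p with
  | ret b => exact h
  | value A k => exact ⟨h.choose, h.choose_spec.1.trans hst, h.choose_spec.2⟩
  | indep A k => exact ⟨h.choose, h.choose_spec.1.trans hst, h.choose_spec.2⟩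
  | draw μ k => exact ⟨h.choose, h.choose_spec.1.trans hst, h.choose_spec.2⟩

theorem Runs.imp {M : Matroid U} {f : Finset U → ℝ} {P Q : β → Prop} {p : OracleProg U β}
    {t : ℕ} (h : Runs M f P p t) (hPQ : ∀ b, P b → Q b) : Runs M f Q p t := by
  induction p generalizing t with
  | ret b => exact hPQ b h
  | value A k ih => exact ⟨h.choose, h.choose_spec.1, ih _ h.choose_spec.2⟩
  | indep A k ih => exact ⟨h.choose, h.choose_spec.1, ih _ h.choose_spec.2⟩
  | draw μ k ih => exact ⟨h.choose, h.choose_spec.1, fun B => ih B (h.choose_spec.2 B)⟩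

theorem Runs.bind {M : Matroid U} {f : Finset U → ℝ} {Q : β → Prop} {P : γ → Prop}
    {p : OracleProg U β} {q : β → OracleProg U γ} {s t : ℕ} (hp : Runs M f Q p s)
    (hq : ∀ b, Q b → Runs M f P (q b) t) : Runs M f P (p.bind q) (s + t) := by
  induction p generalizing s with
  | ret b => exact (hq b hp).mono (Nat.le_add_left _ _)
  | value A k ih => obtain ⟨s', hs', h⟩ := hp; exact ⟨s' + t, by omega, ih _ h⟩
  | indep A k ih => obtain ⟨s', hs', h⟩ := hp; exact ⟨s' + t, by omega, ih _ h⟩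
  | draw μ k ih => obtain ⟨s', hs', h⟩ := hp; exact ⟨s' + t, by omega, fun B => ih B (h B)⟩

theorem Runs.time_le {M : Matroid U} {f : Finset U → ℝ} {P : β → Prop} {p : OracleProg U β}
    {t : ℕ} (h : Runs M f P p t) {z : β × ℕ} (hz : z ∈ (p.run M f).support) : z.2 ≤ t := by
  induction p generalizing t z with
  | ret b => simp [run] at hz; simp [hz]
  | value A k ih =>
    obtain ⟨s, hs, h⟩ := h
    simp only [run, PMF.support_map, Set.mem_image] at hz
    obtain ⟨y, hy, rfl⟩ := hz
    have := ih _ h hy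
    simp only; omega
  | indep A k ih =>
    obtain ⟨s, hs, h⟩ := h
    simp only [run, PMF.support_map, Set.mem_image] at hz
    obtain ⟨y, hy, rfl⟩ := hz
    have := ih _ h hy
    simp only; omega
  | draw μ k ih =>
    obtain ⟨s, hs, h⟩ := h
    simp only [run, PMF.support_map, Set.mem_image, PMF.mem_support_bind_iff] at hz
    obtain ⟨y, ⟨B, -, hy⟩, rfl⟩ := hz
    have := ih _ (h B) hy
    simp only; omega

/-- `Runs` quantifies over all outcomes of a draw, including those of probability zero, so its
postcondition holds surely. -/
theorem Runs.failProb_le {M : Matroid U} {f : Finset U → ℝ} {P : β → Prop} {p : OracleProg U β}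
    {t : ℕ} (h : Runs M f P p t) (a : ℝ≥0∞) : failProb M f p P ≤ a := by
  refine le_trans (le_of_eq ?_) zero_le
  induction p generalizing t with
  | ret b => simpa [failProb, expect, Runs] using h
  | value A k ih => exact ih _ h.choose_spec.2
  | indep A k ih => exact ih _ h.choose_spec.2
  | draw μ k ih =>
    simp only [failProb, expect, ENNReal.tsum_eq_zero]
    intro B
    rw [show expect M f (k B) _ = 0 from ih B (h.choose_spec.2 B), mul_zero]

end OracleProg

/-! ### Marginal values of set functions -/

section Marginals

variable {U : Type u} [DecidableEq U] {f : Finset U → ℝ}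

/-- The marginal values of `f` are decreasing. -/
def AntitoneMarginals (f : Finset U → ℝ) : Prop :=
  ∀ ⦃A B : Finset U⦄, A ⊆ B → ∀ x, f (insert x B) - f B ≤ f (insert x A) - f A

/-- `AntitoneMarginals` allows `x ∈ B`, which spares side conditions later. Monotonicity is needed
for that case: the marginal at `B` is then zero, and the one at `A` must be nonnegative. -/
theorem IsSubmodular.antitoneMarginals (hf : IsSubmodular f) (hm : Monotone f) :
    AntitoneMarginals f := by
  intro A B hAB x
  by_cases hx : x ∈ B
  · rw [Finset.insert_eq_of_mem hx]
    have := hm (Finset.subset_insert x A)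
    linarith
  · have h := hf (insert x A) B
    rw [Finset.insert_union, Finset.union_eq_right.2 hAB, Finset.insert_inter_of_notMem hx,
      Finset.inter_eq_left.2 hAB] at h
    linarith

theorem AntitoneMarginals.antitone (hf : AntitoneMarginals f) (x : U) :
    Antitone fun B => f (insert x B) - f B :=
  fun _ _ h => hf h x

theorem AntitoneMarginals.union_sub_le (hf : AntitoneMarginals f) (B O : Finset U) :
    f (B ∪ O) - f B ≤ ∑ o ∈ O, (f (insert o B) - f B) := by
  induction O using Finset.induction_on with
  | empty => simp
  | insert o O ho ih =>
    rw [Finset.sum_insert ho, Finset.union_insert]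
    have := hf (Finset.subset_union_left : B ⊆ B ∪ O) o
    linarith

theorem AntitoneMarginals.le_sum_singleton (hf : AntitoneMarginals f) (h0 : f ∅ = 0)
    (B : Finset U) : f B ≤ ∑ x ∈ B, f {x} := by
  simpa [h0] using hf.union_sub_le ∅ B

theorem HasCurvature.mono {c c' : ℝ} (hf : HasCurvature f c) (hcc : c ≤ c') (hm : Monotone f)
    (h0 : f ∅ = 0) : HasCurvature f c' := by
  intro A x hx
  refine le_trans (mul_le_mul_of_nonneg_right (by linarith) ?_) (hf A x hx)
  rw [← h0]
  exact hm (Finset.empty_subset _)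

/-- Add the elements of `B \ O` to `O` one at a time; the curvature bounds each gain from below. -/
theorem HasCurvature.add_sum_le {c : ℝ} (hf : HasCurvature f c) (O B : Finset U) :
    f O + (1 - c) * ∑ b ∈ B \ O, f {b} ≤ f (O ∪ B) := by
  induction B using Finset.induction_on with
  | empty => simp
  | insert b B hb ih =>
    by_cases hbO : b ∈ O
    · rw [Finset.insert_sdiff_of_mem _ hbO, Finset.union_insert, Finset.insert_eq_of_mem
        (Finset.mem_union_left _ hbO)]
      exact ih
    · rw [Finset.insert_sdiff_of_notMem _ hbO, Finset.sum_insert (by simp [hb]),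
        Finset.union_insert]
      have := hf (O ∪ B) b (by simp [hb, hbO])
      linarith

end Marginals

/-! ### The multilinear extension -/

section Multilinear

variable {U : Type u}

/-- The expectation of `h` on a random subset of `S` containing each element with probability `p`,
independently. -/
noncomputable def multilinear (p : ℝ) (S : Finset U) (h : Finset U → ℝ) : ℝ :=
  ∑ B ∈ S.powerset, p ^ B.card * (1 - p) ^ (S.card - B.card) * h B

theorem multilinear_empty (p : ℝ) (h : Finset U → ℝ) : multilinear p ∅ h = h ∅ := by
  simp [multilinear]

theorem multilinear_sub (p : ℝ) (S : Finset U) (h k : Finset U → ℝ) :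
    multilinear p S (fun B => h B - k B) = multilinear p S h - multilinear p S k := by
  simp only [multilinear, mul_sub, Finset.sum_sub_distrib]

theorem multilinear_const_mul (p : ℝ) (S : Finset U) (a : ℝ) (h : Finset U → ℝ) :
    multilinear p S (fun B => a * h B) = a * multilinear p S h := by
  simp only [multilinear, Finset.mul_sum]
  exact Finset.sum_congr rfl fun B _ => by ring

theorem multilinear_sum {ι : Type*} (p : ℝ) (S : Finset U) (s : Finset ι)
    (h : ι → Finset U → ℝ) :
    multilinear p S (fun B => ∑ i ∈ s, h i B) = ∑ i ∈ s, multilinear p S (h i) := by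
  simp only [multilinear, Finset.mul_sum]
  exact Finset.sum_comm

theorem multilinear_mono {p : ℝ} (h0 : 0 ≤ p) (h1 : p ≤ 1) {S : Finset U} {h k : Finset U → ℝ}
    (hk : ∀ B ⊆ S, h B ≤ k B) : multilinear p S h ≤ multilinear p S k := by
  refine Finset.sum_le_sum fun B hB => mul_le_mul_of_nonneg_left (hk B (Finset.mem_powerset.1 hB))
    ?_
  have : 0 ≤ 1 - p := by linarith
  positivity

theorem continuous_multilinear (S : Finset U) (h : Finset U → ℝ) :
    Continuous fun p => multilinear p S h := by
  unfold multilinear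
  fun_prop

variable [DecidableEq U]

/-- Condition on whether the random set contains `x`. -/
theorem multilinear_insert (p : ℝ) {S : Finset U} {x : U} (hx : x ∉ S) (h : Finset U → ℝ) :
    multilinear p (insert x S) h =
      p * multilinear p S (fun B => h (insert x B)) + (1 - p) * multilinear p S h := by
  rw [multilinear, Finset.sum_powerset_insert hx, multilinear, multilinear, Finset.mul_sum,
    Finset.mul_sum, add_comm]
  congr 1
  · refine Finset.sum_congr rfl fun B hB => ?_
    have hxB : x ∉ B := fun h => hx (Finset.mem_powerset.1 hB h)
    rw [Finset.card_insert_of_notMem hxB, Finset.card_insert_of_notMem hx, Nat.add_sub_add_right]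
    ring
  · refine Finset.sum_congr rfl fun B hB => ?_
    rw [Finset.card_insert_of_notMem hx,
      Nat.sub_add_comm (Finset.card_le_card (Finset.mem_powerset.1 hB))]
    ring

theorem multilinear_const (p : ℝ) (S : Finset U) (a : ℝ) :
    multilinear p S (fun _ => a) = a := by
  induction S using Finset.induction_on with
  | empty => exact multilinear_empty _ _
  | insert x S hx ih => rw [multilinear_insert p hx, ih]; ring

theorem multilinear_insert_le {p : ℝ} (h0 : 0 ≤ p) (h1 : p ≤ 1) {h : Finset U → ℝ}
    (hh : Antitone h) (S : Finset U) (x : U) :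
    multilinear p (insert x S) h ≤ multilinear p S h := by
  by_cases hx : x ∈ S
  · rw [Finset.insert_eq_of_mem hx]
  · rw [multilinear_insert p hx]
    have : multilinear p S (fun B => h (insert x B)) ≤ multilinear p S h :=
      multilinear_mono h0 h1 fun B _ => hh (Finset.subset_insert x B)
    nlinarith

theorem multilinear_antitone {p : ℝ} (h0 : 0 ≤ p) (h1 : p ≤ 1) {h : Finset U → ℝ}
    (hh : Antitone h) {S T : Finset U} (hST : S ⊆ T) :
    multilinear p T h ≤ multilinear p S h := by
  obtain ⟨R, rfl⟩ : ∃ R, T = R ∪ S := ⟨T, (Finset.union_eq_left.2 hST).symm⟩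
  clear hST
  induction R using Finset.induction_on with
  | empty => simp
  | insert x R hx ih =>
    rw [Finset.insert_union]
    exact (multilinear_insert_le h0 h1 hh _ x).trans ih

/-- Induction on `S`: after conditioning on `x`, the product rule yields the term for `x` and, for
every other `s`, the two halves of the conditioned term for `s`. -/
theorem hasDerivAt_multilinear (S : Finset U) (h : Finset U → ℝ) (p : ℝ) :
    HasDerivAt (fun p => multilinear p S h)
      (∑ s ∈ S, multilinear p (S.erase s) fun B => h (insert s B) - h B) p := by
  induction S using Finset.induction_on generalizing h with
  | empty => simpa [multilinear_empty] using hasDerivAt_const p (h ∅)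
  | insert x S hx ih =>
    simp only [multilinear_insert _ hx]
    have h1 := ((hasDerivAt_id p).mul (ih fun B => h (insert x B))).add
      (((hasDerivAt_id p).const_sub 1).mul (ih h))
    refine h1.congr_deriv ?_
    rw [Finset.sum_insert hx, Finset.erase_insert hx, multilinear_sub]
    have h2 : ∀ s ∈ S, (multilinear p ((insert x S).erase s) fun B => h (insert s B) - h B) =
        p * (multilinear p (S.erase s) fun B => h (insert x (insert s B)) - h (insert x B)) +
          (1 - p) * (multilinear p (S.erase s) fun B => h (insert s B) - h B) := by
      intro s hs
      have hxs : x ≠ s := fun e => hx (e ▸ hs)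
      rw [Finset.erase_insert_of_ne hxs, multilinear_insert p (fun h => hx (Finset.mem_of_mem_erase h))]
      simp only [Finset.insert_comm x s]
    rw [Finset.sum_congr rfl h2, Finset.sum_add_distrib, ← Finset.mul_sum, ← Finset.mul_sum]
    simp only [id]
    ring

end Multilinear

/-! ### The potential function -/

/-- The density `c e^{cp} / (e^c - 1)` on `[0, 1]`. -/
noncomputable def density (c p : ℝ) : ℝ := c * Real.exp (c * p) / (Real.exp c - 1)

theorem continuous_density (c : ℝ) : Continuous (density c) := by
  unfold density
  fun_prop

theorem continuous_density_mul_multilinear {U : Type u} (c : ℝ) (S : Finset U)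
    (h : Finset U → ℝ) : Continuous fun p => density c p * multilinear p S h :=
  (continuous_density c).mul (continuous_multilinear S h)

theorem exp_sub_one_pos {c : ℝ} (hc : 0 < c) : 0 < Real.exp c - 1 := by
  have := Real.add_one_lt_exp hc.ne'
  linarith

theorem density_pos {c : ℝ} (hc : 0 < c) (p : ℝ) : 0 < density c p :=
  div_pos (mul_pos hc (Real.exp_pos _)) (exp_sub_one_pos hc)

/-- This differential equation is the reason for the exponential density: it lets the integration by
parts in `sum_potential_sub_le` return a multiple of the original integral. -/
theorem hasDerivAt_density (c p : ℝ) : HasDerivAt (density c) (c * density c p) p := by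
  unfold density
  have h := ((((hasDerivAt_id p).const_mul c).exp).const_mul c).div_const (Real.exp c - 1)
  refine h.congr_deriv ?_
  simp only [id]
  ring

theorem integral_density {c : ℝ} (hc : 0 < c) : ∫ p in (0 : ℝ)..1, density c p = 1 := by
  have h : ∀ p ∈ Set.uIcc (0 : ℝ) 1, HasDerivAt (fun p => c⁻¹ * density c p) (density c p) p := by
    intro p _
    refine ((hasDerivAt_density c p).const_mul c⁻¹).congr_deriv ?_
    field_simp
  rw [intervalIntegral.integral_eq_sub_of_hasDerivAt h
    ((continuous_density c).intervalIntegrable _ _)]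
  have := (exp_sub_one_pos hc).ne'
  simp only [density, mul_one, mul_zero, Real.exp_zero]
  field_simp

theorem density_le {c : ℝ} (hc : 0 < c) {p : ℝ} (hp : p ≤ 1) : density c p ≤ density c 1 := by
  unfold density
  have := exp_sub_one_pos hc
  gcongr

theorem mcoeff_eq (c : ℝ) (a b : ℕ) :
    mcoeff c a b = ∫ p in (0 : ℝ)..1, density c p * (p ^ b * (1 - p) ^ (a - b)) := rfl

theorem mcoeff_pos {c : ℝ} (hc : 0 < c) (a b : ℕ) : 0 < mcoeff c a b := by
  rw [mcoeff_eq]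
  have hcont : Continuous fun p : ℝ => density c p * (p ^ b * (1 - p) ^ (a - b)) := by
    have := continuous_density c
    fun_prop
  refine intervalIntegral.intervalIntegral_pos_of_pos_on (hcont.intervalIntegrable _ _) ?_
    one_pos
  intro p hp
  have h1 : 0 < 1 - p := by linarith [hp.2]
  have h2 := hp.1
  have h3 := density_pos hc p
  positivity

/-- The integrands add up because `p + (1 - p) = 1`. -/
theorem mcoeff_succ_succ (c : ℝ) {a b : ℕ} (hab : b ≤ a) :
    mcoeff c (a + 1) (b + 1) + mcoeff c (a + 1) b = mcoeff c a b := by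
  simp only [mcoeff_eq]
  have := continuous_density c
  rw [← intervalIntegral.integral_add]
  · refine intervalIntegral.integral_congr fun p _ => ?_
    simp only [Nat.add_sub_add_right, Nat.sub_add_comm hab]
    ring
  · exact Continuous.intervalIntegrable (by fun_prop) _ _
  · exact Continuous.intervalIntegrable (by fun_prop) _ _

section Potential

variable {U : Type u}

/-- The potential `g(A) = ∑_{B ⊆ A} m_{|A| - 1, |B| - 1} f(B)`. -/
noncomputable def potential (c : ℝ) (f : Finset U → ℝ) (A : Finset U) : ℝ :=
  ∑ B ∈ A.powerset, weight c A B * f B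

theorem weight_nonneg {c : ℝ} (hc : 0 < c) (A B : Finset U) : 0 ≤ weight c A B := by
  unfold weight
  split_ifs
  · exact le_rfl
  · exact (mcoeff_pos hc _ _).le

theorem tau_pos {c : ℝ} (hc : 0 < c) {A : Finset U} (hA : A.Nonempty) : 0 < tau c A := by
  refine Finset.sum_pos' (fun B _ => weight_nonneg hc A B) ⟨A, by simp, ?_⟩
  rw [weight, if_neg (Finset.card_pos.2 hA).ne']
  exact mcoeff_pos hc _ _

theorem potential_empty (c : ℝ) (f : Finset U → ℝ) : potential c f ∅ = 0 := by
  simp [potential, weight]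

theorem potential_le_tau_mul {c : ℝ} (hc : 0 < c) {f : Finset U → ℝ} (hf : Monotone f)
    (A : Finset U) : potential c f A ≤ tau c A * f A := by
  rw [tau, Finset.sum_mul]
  exact Finset.sum_le_sum fun B hB =>
    mul_le_mul_of_nonneg_left (hf (Finset.mem_powerset.1 hB)) (weight_nonneg hc A B)

variable [DecidableEq U]

/-- Let `a = |A|` and `B ⊆ A` be nonempty. In `A + x` the sets `B` and `B + x` have weights
`m_{a,|B|-1}` and `m_{a,|B|}`, whose sum is the weight of `B` in `A`. So the difference is
`m_{a,|B|} (f(B + x) - f(B))`, and `m_{a,|B|}` is the averaged probability that the random subset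
equals `B`. -/
theorem potential_insert_sub {c : ℝ} {f : Finset U → ℝ} (h0 : f ∅ = 0) {A : Finset U} {x : U}
    (hx : x ∉ A) :
    potential c f (insert x A) - potential c f A =
      ∫ p in (0 : ℝ)..1, density c p * multilinear p A fun B => f (insert x B) - f B := by
  have hd := continuous_density c
  have h1 : ∀ B : Finset U,
      ∫ p in (0 : ℝ)..1, density c p * (p ^ B.card * (1 - p) ^ (A.card - B.card) *
        (f (insert x B) - f B)) = mcoeff c A.card B.card * (f (insert x B) - f B) := by
    intro B
    rw [mcoeff_eq, ← intervalIntegral.integral_mul_const]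
    exact intervalIntegral.integral_congr fun p _ => by ring
  simp only [multilinear, Finset.mul_sum]
  rw [intervalIntegral.integral_finsetSum
    fun B _ => Continuous.intervalIntegrable (by fun_prop) _ _]
  simp only [h1]
  rw [potential, Finset.sum_powerset_insert hx, potential, ← Finset.sum_add_distrib,
    ← Finset.sum_sub_distrib]
  refine Finset.sum_congr rfl fun B hB => ?_
  have hBA := Finset.mem_powerset.1 hB
  have hxB : x ∉ B := fun h => hx (hBA h)
  have hle := Finset.card_le_card hBA
  -- The recurrence does not apply to the empty set, whose weight is `0` by convention; there `f ∅ =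
  -- 0` takes its place.
  rcases B.eq_empty_or_nonempty with rfl | hne
  · simp [h0, weight, Finset.card_insert_of_notMem hx]
  · obtain ⟨b, hb⟩ := Nat.exists_eq_add_of_lt (Finset.card_pos.2 hne)
    obtain ⟨a, ha⟩ := Nat.exists_eq_add_of_lt (lt_of_lt_of_le (Finset.card_pos.2 hne) hle)
    rw [zero_add] at hb ha
    simp only [weight, Finset.card_insert_of_notMem hx, Finset.card_insert_of_notMem hxB, hb, ha,
      Nat.add_eq_zero_iff, one_ne_zero, and_false, if_false, Nat.add_sub_cancel]
    rw [← mcoeff_succ_succ c (show b ≤ a by omega)]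
    ring

theorem integral_density_mul_le {c : ℝ} (hc : 0 < c) {h k : ℝ → ℝ} (hh : Continuous h)
    (hk : Continuous k) (hhk : ∀ p, 0 ≤ p → p ≤ 1 → h p ≤ k p) :
    ∫ p in (0 : ℝ)..1, density c p * h p ≤ ∫ p in (0 : ℝ)..1, density c p * k p := by
  have hd := continuous_density c
  refine intervalIntegral.integral_mono_on zero_le_one
    (Continuous.intervalIntegrable (by fun_prop) _ _)
    (Continuous.intervalIntegrable (by fun_prop) _ _) fun p hp => ?_
  exact mul_le_mul_of_nonneg_left (hhk p hp.1 hp.2) (density_pos hc p).le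

theorem integral_density_mul_const {c : ℝ} (hc : 0 < c) (a : ℝ) :
    ∫ p in (0 : ℝ)..1, density c p * a = a := by
  rw [intervalIntegral.integral_mul_const, integral_density hc, one_mul]

theorem potential_le_insert {c : ℝ} (hc : 0 < c) {f : Finset U → ℝ} (h0 : f ∅ = 0)
    (hf : Monotone f) (A : Finset U) (x : U) : potential c f A ≤ potential c f (insert x A) := by
  by_cases hx : x ∈ A
  · rw [Finset.insert_eq_of_mem hx]
  · rw [← sub_nonneg, potential_insert_sub h0 hx]
    calc (0 : ℝ) = ∫ p in (0 : ℝ)..1, density c p * 0 := (integral_density_mul_const hc 0).symm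
      _ ≤ _ := by
        refine integral_density_mul_le hc continuous_const (continuous_multilinear _ _)
          fun p hp0 hp1 => ?_
        rw [← multilinear_const p A 0]
        exact multilinear_mono hp0 hp1 fun B _ => sub_nonneg.2 (hf (Finset.subset_insert x B))

theorem potential_monotone {c : ℝ} (hc : 0 < c) {f : Finset U → ℝ} (h0 : f ∅ = 0)
    (hf : Monotone f) : Monotone (potential c f) := by
  intro A B hAB
  obtain ⟨R, rfl⟩ : ∃ R, B = R ∪ A := ⟨B, (Finset.union_eq_left.2 hAB).symm⟩
  clear hAB
  induction R using Finset.induction_on with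
  | empty => simp
  | insert x R hx ih =>
    rw [Finset.insert_union]
    exact ih.trans (potential_le_insert hc h0 hf _ x)

theorem potential_antitoneMarginals {c : ℝ} (hc : 0 < c) {f : Finset U → ℝ} (h0 : f ∅ = 0)
    (hf : Monotone f) (ha : AntitoneMarginals f) : AntitoneMarginals (potential c f) := by
  intro A B hAB x
  by_cases hx : x ∈ B
  · rw [Finset.insert_eq_of_mem hx, sub_self, sub_nonneg]
    exact potential_le_insert hc h0 hf _ _
  · rw [potential_insert_sub h0 hx, potential_insert_sub h0 fun h => hx (hAB h)]
    exact integral_density_mul_le hc (continuous_multilinear _ _) (continuous_multilinear _ _)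
      fun p hp0 hp1 => multilinear_antitone hp0 hp1 (ha.antitone x) hAB

/-- A marginal of `g` at `A` averages marginals of `f` at subsets of `A`, each at least the marginal
of `f` at `A`. Sum along a chain from `∅`. -/
theorem le_potential {c : ℝ} (hc : 0 < c) {f : Finset U → ℝ} (h0 : f ∅ = 0)
    (ha : AntitoneMarginals f) (A : Finset U) : f A ≤ potential c f A := by
  induction A using Finset.induction_on with
  | empty => rw [h0, potential_empty]
  | insert x A hx ih =>
    have h1 := potential_insert_sub (c := c) h0 hx
    have h2 : f (insert x A) - f A ≤
        ∫ p in (0 : ℝ)..1, density c p * multilinear p A fun B => f (insert x B) - f B := by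
      rw [← integral_density_mul_const hc (f (insert x A) - f A)]
      refine integral_density_mul_le hc continuous_const (continuous_multilinear _ _)
        fun p hp0 hp1 => ?_
      rw [← multilinear_const p A (f (insert x A) - f A)]
      exact multilinear_mono hp0 hp1 fun B hB => ha hB x
    linarith

/-- `τ` is itself the potential of the indicator of nonempty sets. Its marginal at `A` integrates
the probability `(1 - p)^{|A|}` that the random subset is empty; bounding the density by its value
at `1` leaves `1/(|A| + 1)`, the next harmonic term. -/
theorem tau_le {c : ℝ} (hc : 0 < c) (A : Finset U) :
    tau c A ≤ density c 1 * (harmonic A.card : ℝ) := by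
  have hτ : ∀ A : Finset U, tau c A = potential c (fun B => if B = ∅ then 0 else 1) A := by
    intro A
    refine Finset.sum_congr rfl fun B _ => ?_
    by_cases hB : B = ∅ <;> simp [hB, weight]
  rw [hτ]
  induction A using Finset.induction_on with
  | empty => simp [potential_empty]
  | insert x A hx ih =>
    have h1 := potential_insert_sub (c := c)
      (f := fun B : Finset U => if B = ∅ then (0 : ℝ) else 1) (by simp) hx
    have h2 : ∀ p : ℝ, (multilinear p A fun B => (if insert x B = ∅ then (0 : ℝ) else 1) -
        (if B = ∅ then 0 else 1)) = (1 - p) ^ A.card := by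
      intro p
      rw [multilinear, Finset.sum_eq_single ∅]
      · simp
      · intro B _ hB
        simp [hB]
      · simp
    simp only [h2] at h1
    have h3 : ∫ p in (0 : ℝ)..1, density c p * (1 - p) ^ A.card ≤
        ∫ p in (0 : ℝ)..1, density c 1 * (1 - p) ^ A.card := by
      have hd := continuous_density c
      refine intervalIntegral.integral_mono_on zero_le_one
        (Continuous.intervalIntegrable (by fun_prop) _ _)
        (Continuous.intervalIntegrable (by fun_prop) _ _) fun p hp => ?_
      have : 0 ≤ 1 - p := by linarith [hp.2]
      exact mul_le_mul_of_nonneg_right (density_le hc hp.2) (by positivity)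
    have h4 : ∫ p in (0 : ℝ)..1, density c 1 * (1 - p) ^ A.card =
        density c 1 * ((A.card : ℝ) + 1)⁻¹ := by
      rw [intervalIntegral.integral_const_mul,
        intervalIntegral.integral_comp_sub_left (fun q : ℝ => q ^ A.card) 1]
      simp [integral_pow]
    rw [Finset.card_insert_of_notMem hx, harmonic_succ]
    push_cast
    linarith

/-! ### The value of a locally optimal solution -/

/-- Condition on `s ∈ B`. If `o ≠ s`, then `o ∉ S` and submodularity suffices. If `o = s`, the
marginal vanishes when `s ∈ B`, and the extra term `(1 - c) f {o}` is what the curvature guarantees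
for the marginal with `s` removed. -/
theorem multilinear_erase_ge {c : ℝ} {f : Finset U → ℝ} (ha : AntitoneMarginals f)
    (hcurv : HasCurvature f c) {S : Finset U} {s o : U} (hs : s ∈ S)
    (hso : o ∉ S.erase s) {p : ℝ} (hp0 : 0 ≤ p) (hp1 : p ≤ 1) :
    multilinear p S (fun B => f (insert o B) - f B + if o ∈ B then (1 - c) * f {o} else 0) ≤
      multilinear p (S.erase s) fun B => f (insert o B) - f B := by
  conv_lhs => rw [← Finset.insert_erase hs]
  rw [multilinear_insert p (Finset.notMem_erase s S)]
  have h1 : multilinear p (S.erase s)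
      (fun B => f (insert o (insert s B)) - f (insert s B) +
        if o ∈ insert s B then (1 - c) * f {o} else 0) ≤
      multilinear p (S.erase s) fun B => f (insert o B) - f B := by
    refine multilinear_mono hp0 hp1 fun B hB => ?_
    have hoB : o ∉ B := fun h => hso (hB h)
    by_cases hos : o = s
    · subst hos
      simpa using hcurv B o hoB
    · simpa [hos, hoB] using ha (Finset.subset_insert s B) o
  have h2 : multilinear p (S.erase s)
      (fun B => f (insert o B) - f B + if o ∈ B then (1 - c) * f {o} else 0) ≤
      multilinear p (S.erase s) fun B => f (insert o B) - f B := by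
    refine multilinear_mono hp0 hp1 fun B hB => ?_
    have hoB : o ∉ B := fun h => hso (hB h)
    simp [hoB]
  nlinarith

/-- The marginals sum to at least `f(O ∪ B) - f(B)`, and `f(O ∪ B)` exceeds `f(O)` by at least `(1 -
c) ∑ f {b}` over `B \ O`. The extra terms supply the same sum over `B ∩ O`; together they give at
least `(1 - c) f(B)`. -/
theorem le_sum_marginals {c : ℝ} {f : Finset U → ℝ} (h0 : f ∅ = 0)
    (ha : AntitoneMarginals f) (hc1 : c ≤ 1) (hcurv : HasCurvature f c) (O B : Finset U) :
    f O - c * f B ≤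
      ∑ o ∈ O, (f (insert o B) - f B + if o ∈ B then (1 - c) * f {o} else 0) := by
  rw [Finset.sum_add_distrib, ← Finset.sum_filter, ← Finset.mul_sum, Finset.filter_mem_eq_inter]
  have h1 := ha.union_sub_le B O
  have h2 := hcurv.add_sum_le O B
  have h3 := ha.le_sum_singleton h0 B
  rw [← Finset.sum_inter_add_sum_sdiff B O] at h3
  rw [Finset.union_comm] at h2
  rw [Finset.inter_comm]
  nlinarith [mul_le_mul_of_nonneg_left h3 (sub_nonneg.2 hc1)]

/-- Comparison of a solution `S` with a solution `O`, through the change of the potential under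
the exchanges given by a bijection between them. -/
theorem sum_potential_sub_le {c : ℝ} (hc : 0 < c) (hc1 : c ≤ 1) {f : Finset U → ℝ}
    (h0 : f ∅ = 0) (ha : AntitoneMarginals f) (hcurv : HasCurvature f c)
    {S O : Finset U} {π : U → U} (hπ : Set.BijOn π O S) (hπ' : ∀ o ∈ O, o ∉ S.erase (π o)) :
    ∑ o ∈ O, (potential c f S - potential c f (insert o (S.erase (π o)))) ≤
      density c 1 * f S - f O := by
  have hd := continuous_density c
  have hmem : ∀ o ∈ O, π o ∈ S := fun o ho => hπ.mapsTo ho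
  set F : ℝ → ℝ := fun p => multilinear p S f with hF
  set F' : ℝ → ℝ := fun p =>
    ∑ s ∈ S, multilinear p (S.erase s) fun B => f (insert s B) - f B with hF'
  have hFc : Continuous F := continuous_multilinear S f
  have hF'c : Continuous F' := continuous_finsetSum _ fun s _ => continuous_multilinear _ _
  -- the part due to the removed elements
  have e1 : ∑ o ∈ O, (potential c f S - potential c f (S.erase (π o))) =
      ∫ p in (0 : ℝ)..1, density c p * F' p := by
    have : ∑ o ∈ O, (potential c f S - potential c f (S.erase (π o))) =
        ∑ s ∈ S, (potential c f S - potential c f (S.erase s)) :=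
      Finset.sum_bij (fun o _ => π o) hmem (fun a ha b hb h => hπ.injOn ha hb h)
        (fun s hs => by simpa using hπ.surjOn hs) fun _ _ => rfl
    rw [this]
    simp only [hF', Finset.mul_sum]
    rw [intervalIntegral.integral_finsetSum fun s _ =>
      (continuous_density_mul_multilinear c _ _).intervalIntegrable _ _]
    refine Finset.sum_congr rfl fun s hs => ?_
    rw [← potential_insert_sub h0 (Finset.notMem_erase s S), Finset.insert_erase hs]
  -- Integration by parts, with boundary values `F(0) = f ∅ = 0` and `F(1) = f(S)`.
  have e2 : ∫ p in (0 : ℝ)..1, density c p * F' p =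
      density c 1 * f S - c * ∫ p in (0 : ℝ)..1, density c p * F p := by
    have h := intervalIntegral.integral_mul_deriv_eq_deriv_mul (a := (0 : ℝ)) (b := 1)
      (fun p _ => hasDerivAt_density c p) (fun p _ => hasDerivAt_multilinear S f p)
      ((hd.const_smul c).intervalIntegrable _ _) (hF'c.intervalIntegrable _ _)
    have hF0 : multilinear 0 S f = 0 := by
      rw [multilinear, Finset.sum_eq_zero]
      intro B _
      rcases B.eq_empty_or_nonempty with rfl | hB
      · simp [h0]
      · simp [zero_pow (Finset.card_pos.2 hB).ne']
    have hF1 : multilinear 1 S f = f S := by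
      rw [multilinear, Finset.sum_eq_single S]
      · simp
      · intro B hB hne
        have := Finset.card_lt_card ((Finset.mem_powerset.1 hB).ssubset_of_ne hne)
        simp [zero_pow (Nat.sub_ne_zero_of_lt this)]
      · simp
    rw [h, hF0, hF1, ← intervalIntegral.integral_const_mul]
    simp only [mul_zero, sub_zero, mul_assoc]
    rfl
  -- the part due to the added elements
  have e3 : ∑ o ∈ O, (potential c f (insert o (S.erase (π o))) - potential c f (S.erase (π o))) =
      ∫ p in (0 : ℝ)..1, density c p *
        ∑ o ∈ O, multilinear p (S.erase (π o)) fun B => f (insert o B) - f B := by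
    simp only [Finset.mul_sum]
    rw [intervalIntegral.integral_finsetSum fun s _ =>
      (continuous_density_mul_multilinear c _ _).intervalIntegrable _ _]
    exact Finset.sum_congr rfl fun o ho => potential_insert_sub h0 (hπ' o ho)
  -- It suffices to compare at each `p`: take expectations in `le_sum_marginals` over a random `B ⊆
  -- S`, then pass from `S` to `S - π(o)` term by term.
  have e4 : f O - c * ∫ p in (0 : ℝ)..1, density c p * F p ≤
      ∫ p in (0 : ℝ)..1, density c p *
        ∑ o ∈ O, multilinear p (S.erase (π o)) fun B => f (insert o B) - f B := by
    have : f O - c * ∫ p in (0 : ℝ)..1, density c p * F p =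
        ∫ p in (0 : ℝ)..1, density c p * (f O - c * F p) := by
      rw [← intervalIntegral.integral_const_mul, ← integral_density_mul_const hc (f O),
        ← intervalIntegral.integral_sub (Continuous.intervalIntegrable (by fun_prop) _ _)
        (Continuous.intervalIntegrable (by fun_prop) _ _)]
      simp only [integral_density_mul_const hc]
      exact intervalIntegral.integral_congr fun p _ => by ring
    rw [this]
    refine integral_density_mul_le hc (by fun_prop)
      (continuous_finsetSum _ fun s _ => continuous_multilinear _ _) fun p hp0 hp1 => ?_
    calc f O - c * F p = multilinear p S fun B => f O - c * f B := by
          rw [multilinear_sub, multilinear_const, multilinear_const_mul]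
      _ ≤ multilinear p S fun B =>
          ∑ o ∈ O, (f (insert o B) - f B + if o ∈ B then (1 - c) * f {o} else 0) :=
          multilinear_mono hp0 hp1 fun B _ => le_sum_marginals h0 ha hc1 hcurv O B
      _ ≤ _ := by
          rw [multilinear_sum]
          exact Finset.sum_le_sum fun o ho =>
            multilinear_erase_ge ha hcurv (hmem o ho) (hπ' o ho) hp0 hp1
  have e5 : ∑ o ∈ O, (potential c f S - potential c f (insert o (S.erase (π o)))) =
      ∑ o ∈ O, (potential c f S - potential c f (S.erase (π o))) -
      ∑ o ∈ O, (potential c f (insert o (S.erase (π o))) - potential c f (S.erase (π o))) := by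
    rw [← Finset.sum_sub_distrib]
    exact Finset.sum_congr rfl fun o _ => by ring
  rw [e5, e1, e2, e3]
  linarith

end Potential

/-! ### Exchange bijections between bases of a matroid -/

section MatroidExchange

variable {U : Type u} {M : Matroid U}

/-- A proper subset `N` of `S` is the intersection of the sets `S - s` with `s ∈ S \ N`, and closure
commutes with intersections of subsets of an independent set. -/
theorem mem_closure_of_isBase {S : Finset U} (hS : M.IsBase (S : Set U)) {N : Set U} (hN : N ⊆ S)
    {o : U} (ho : o ∈ M.E) (h : ∀ s ∈ S, s ∉ N → o ∈ M.closure ((S : Set U) \ {s})) :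
    o ∈ M.closure N := by
  rcases ((S : Set U) \ N).eq_empty_or_nonempty with he | hne
  · rw [hN.antisymm (Set.sdiff_eq_empty.1 he), hS.closure_eq]
    exact ho
  · have hi : ⋂ s ∈ (S : Set U) \ N, ((S : Set U) \ {s}) = N := by
      ext x
      simp only [Set.mem_iInter, Set.mem_sdiff, Set.mem_singleton_iff]
      constructor
      · intro hx
        obtain ⟨s, hs⟩ := hne
        by_contra hxN
        exact (hx x ⟨(hx s hs).1, hxN⟩).2 rfl
      · exact fun hx s hs => ⟨hN hx, fun e => hs.2 (e ▸ hx)⟩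
    rw [← hi, Matroid.closure_biInter_eq_biInter_closure_of_biUnion_indep
      (I := fun s => (S : Set U) \ {s}) hne
      (hS.indep.subset (Set.iUnion₂_subset fun s _ => Set.sdiff_subset))]
    simp only [Set.mem_iInter]
    exact fun s hs => h s hs.1 hs.2

theorem card_le_of_indep {r : ℕ} (hr : M.eRank = (r : ℕ∞)) {A : Finset U}
    (hA : M.Indep (A : Set U)) : A.card ≤ r := by
  have := hA.encard_le_eRank
  rw [hr, Set.encard_coe_eq_coe_finsetCard] at this
  exact_mod_cast this

theorem exists_base_superset [Fintype U] {r : ℕ} (hr : M.eRank = (r : ℕ∞)) {A : Finset U}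
    (hA : M.Indep (A : Set U)) :
    ∃ B : Finset U, A ⊆ B ∧ M.IsBase (B : Set U) ∧ B.card = r := by
  classical
  obtain ⟨B, hB, hAB⟩ := hA.exists_isBase_superset
  refine ⟨B.toFinset, fun x hx => by simpa using hAB hx, by simpa using hB, ?_⟩
  have := hB.encard_eq_eRank
  rw [hr, Set.encard_eq_coe_toFinset_card] at this
  exact_mod_cast this

theorem isBase_of_card_eq [Fintype U] {r : ℕ} (hr : M.eRank = (r : ℕ∞)) {A : Finset U}
    (hA : M.Indep (A : Set U)) (hcard : A.card = r) : M.IsBase (A : Set U) := by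
  obtain ⟨B, hAB, hB, hBr⟩ := exists_base_superset hr hA
  rwa [Finset.eq_of_subset_of_card_le hAB (by omega)]

variable [DecidableEq U]

/-- For bases `S` and `O` there is a bijection `π` from `O` to `S` such that `S - π(o) + o` is
independent for all `o ∈ O`. -/
theorem exists_exchange_bijOn {S O : Finset U} (hS : M.IsBase (S : Set U))
    (hO : M.Indep (O : Set U)) (hcard : O.card = S.card) :
    ∃ π : U → U, Set.BijOn π O S ∧
      ∀ o ∈ O, o ∉ S.erase (π o) ∧ M.Indep (insert o (S.erase (π o)) : Finset U) := by
  classical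
  -- The admissible partners of `o`: those `s` for which `o` is not spanned by `S - s`.
  set t : O → Finset U := fun o => S.filter fun s => (o : U) ∉ M.closure ((S : Set U) \ {s})
    with ht
  have hall : ∀ X : Finset O, X.card ≤ (X.biUnion t).card := by
    intro X
    -- Hall's condition: no element of `X` has a partner outside the neighbourhood of `X`, so that
    -- neighbourhood spans `X`. As `X` is independent, it is no larger than its neighbourhood.
    have hsub : ((X.map (Function.Embedding.subtype _) : Finset U) : Set U) ⊆
        M.closure (X.biUnion t : Finset U) := by
      intro o ho
      simp only [Finset.coe_map, Function.Embedding.subtype_apply, Set.mem_image, Finset.mem_coe]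
        at ho
      obtain ⟨o, hoX, rfl⟩ := ho
      refine mem_closure_of_isBase hS ?_ (hO.subset_ground o.2) ?_
      · intro s hs
        obtain ⟨o', -, h⟩ := Finset.mem_biUnion.1 (Finset.mem_coe.1 hs)
        exact (Finset.mem_filter.1 h).1
      · intro s hs hsn
        by_contra h
        exact hsn (Finset.mem_coe.2 (Finset.mem_biUnion.2
          ⟨o, hoX, Finset.mem_filter.2 ⟨hs, h⟩⟩))
    have hind : M.Indep ((X.map (Function.Embedding.subtype _) : Finset U) : Set U) := by
      refine hO.subset fun o ho => ?_
      simp only [Finset.coe_map, Function.Embedding.subtype_apply, Set.mem_image] at ho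
      obtain ⟨o, -, rfl⟩ := ho
      exact o.2
    have h := (hind.encard_le_eRk_of_subset hsub).trans
      ((M.eRk_closure_eq _).le.trans (M.eRk_le_encard _))
    rw [Set.encard_coe_eq_coe_finsetCard, Set.encard_coe_eq_coe_finsetCard, Finset.card_map] at h
    exact_mod_cast h
  obtain ⟨φ, hφ, hφt⟩ := (Finset.all_card_le_biUnion_card_iff_exists_injective t).1 hall
  refine ⟨fun u => if h : u ∈ O then φ ⟨u, h⟩ else u, ?_, ?_⟩
  · have hmaps : Set.MapsTo (fun u => if h : u ∈ O then φ ⟨u, h⟩ else u) (O : Set U) S := by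
      intro o ho
      simp only [dif_pos (Finset.mem_coe.1 ho)]
      exact (Finset.mem_filter.1 (hφt _)).1
    have hinj : Set.InjOn (fun u => if h : u ∈ O then φ ⟨u, h⟩ else u) (O : Set U) := by
      intro a ha b hb hab
      simp only [dif_pos (Finset.mem_coe.1 ha), dif_pos (Finset.mem_coe.1 hb)] at hab
      exact congrArg Subtype.val (hφ hab)
    exact ⟨hmaps, hinj, Finset.surjOn_of_injOn_of_card_le _ hmaps hinj hcard.ge⟩
  · intro o ho
    simp only [dif_pos ho]
    have h := (Finset.mem_filter.1 (hφt ⟨o, ho⟩)).2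
    set s := φ ⟨o, ho⟩
    have hi : M.Indep ((S : Set U) \ {s}) := hS.indep.subset Set.sdiff_subset
    have hoE := hO.subset_ground ho
    rw [hi.notMem_closure_iff hoE] at h
    refine ⟨fun hm => h.2 ?_, ?_⟩
    · simpa [and_comm] using hm
    · simpa using h.1

theorem exists_insert_indep {A B : Finset U} (hA : M.Indep (A : Set U)) (hB : M.Indep (B : Set U))
    (hcard : A.card < B.card) : ∃ x ∈ B, x ∉ A ∧ M.Indep (insert x A : Finset U) := by
  obtain ⟨e, he, h⟩ := hA.exists_insert_of_encard_lt hB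
    (by simpa [Set.encard_coe_eq_coe_finsetCard] using hcard)
  exact ⟨e, he.1, he.2, by simpa using h⟩

end MatroidExchange

/-! ### Concentration of the estimates -/

section Concentration

open OracleProg ProbabilityTheory MeasureTheory
open scoped ENNReal

variable {U : Type u}

/-- Hoeffding's lemma for a probability mass function on a finite type. -/
theorem tsum_mul_exp_le {α : Type v} [Fintype α] (μ : PMF α) {X : α → ℝ} {b : ℝ}
    (hX : ∀ B, μ B ≠ 0 → X B ∈ Set.Icc 0 b) (t : ℝ) :
    ∑' B, μ B * ENNReal.ofReal (Real.exp (t * (X B - ∑ A, (μ A).toReal * X A))) ≤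
      ENNReal.ofReal (Real.exp (b ^ 2 * t ^ 2 / 8)) := by
  let _ : MeasurableSpace α := ⊤
  have _ : MeasurableSingletonClass α := ⟨fun _ => trivial⟩
  have hae : ∀ᵐ B ∂μ.toMeasure, X B ∈ Set.Icc 0 b := by
    rw [ae_iff, PMF.toMeasure_apply_eq_zero_iff _ (MeasurableSpace.measurableSet_top), Set.disjoint_left]
    intro B hB hn
    exact hn (hX B ((PMF.mem_support_iff _ _).1 hB))
  have h := (hasSubgaussianMGF_of_mem_Icc (μ := μ.toMeasure) (X := X)
    measurable_from_top.aemeasurable hae).mgf_le t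
  rw [mgf, PMF.integral_eq_sum, PMF.integral_eq_sum] at h
  simp only [smul_eq_mul] at h
  rw [tsum_fintype]
  have e : ∀ B, μ B * ENNReal.ofReal (Real.exp (t * (X B - ∑ A, (μ A).toReal * X A))) =
      ENNReal.ofReal ((μ B).toReal * Real.exp (t * (X B - ∑ A, (μ A).toReal * X A))) := by
    intro B
    rw [ENNReal.ofReal_mul ENNReal.toReal_nonneg, ENNReal.ofReal_toReal (μ.apply_ne_top B)]
  simp only [e]
  rw [← ENNReal.ofReal_sum_of_nonneg fun B _ => by positivity]
  refine ENNReal.ofReal_le_ofReal (h.trans_eq ?_)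
  congr 1
  push_cast
  rw [sub_zero, Real.norm_eq_abs, div_pow, sq_abs]
  ring

/-- The samples are independent, so the centred exponential moments multiply. -/
theorem expect_sumSamples_le [Fintype U] (M : Matroid U) {f : Finset U → ℝ}
    (μ : PMF (Finset U)) {b : ℝ} (hb : ∀ B, μ B ≠ 0 → f B ∈ Set.Icc 0 b) (t : ℝ) (N : ℕ) :
    expect M f (sumSamples μ N)
      (fun s => ENNReal.ofReal (Real.exp (t * (s - N * ∑ B, (μ B).toReal * f B)))) ≤
      ENNReal.ofReal (Real.exp (b ^ 2 * t ^ 2 / 8)) ^ N := by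
  set m := ∑ B, (μ B).toReal * f B
  induction N with
  | zero => simp [sumSamples, expect]
  | succ N ih =>
    simp only [sumSamples, expect, expect_bind]
    have e : ∀ B s, ENNReal.ofReal (Real.exp (t * (f B + s - ((N + 1 : ℕ) : ℝ) * m))) =
        ENNReal.ofReal (Real.exp (t * (s - N * m))) * ENNReal.ofReal (Real.exp (t * (f B - m))) := by
      intro B s
      rw [← ENNReal.ofReal_mul (Real.exp_pos _).le, ← Real.exp_add]
      congr 2
      push_cast
      ring
    simp only [e, expect_mul_const]
    calc ∑' B, μ B * (expect M f (sumSamples μ N)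
            (fun s => ENNReal.ofReal (Real.exp (t * (s - N * m)))) *
            ENNReal.ofReal (Real.exp (t * (f B - m))))
        = expect M f (sumSamples μ N) (fun s => ENNReal.ofReal (Real.exp (t * (s - N * m)))) *
            ∑' B, μ B * ENNReal.ofReal (Real.exp (t * (f B - m))) := by
          rw [← ENNReal.tsum_mul_left]
          exact tsum_congr fun B => by ring
      _ ≤ _ := by
          rw [pow_succ]
          exact mul_le_mul' ih (tsum_mul_exp_le μ hb t)

/-- Hoeffding's inequality for the sum of the samples. -/
theorem failProb_sumSamples_le [Fintype U] (M : Matroid U) {f : Finset U → ℝ}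
    (μ : PMF (Finset U)) {b : ℝ} (hb0 : 0 < b) (hb : ∀ B, μ B ≠ 0 → f B ∈ Set.Icc 0 b) {N : ℕ}
    (hN : 0 < N) {a : ℝ} (ha : 0 ≤ a) :
    failProb M f (sumSamples μ N) (fun s => |s - N * ∑ B, (μ B).toReal * f B| ≤ a) ≤
      ENNReal.ofReal (2 * Real.exp (-(2 * a ^ 2 / (N * b ^ 2)))) := by
  have hN' : (0 : ℝ) < N := by exact_mod_cast hN
  -- Chernoff's bound for both tails: `t = ±4a/(N b²)` minimizes `N b² t²/8 - |t| a`, with minimum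
  -- `-2a²/(N b²)`.
  have key : ∀ t : ℝ, t ^ 2 = (4 * a / (N * b ^ 2)) ^ 2 →
      expect M f (sumSamples μ N)
        (fun s => ENNReal.ofReal (Real.exp (t * (s - N * ∑ B, (μ B).toReal * f B))) *
          ENNReal.ofReal (Real.exp (-(4 * a ^ 2 / (N * b ^ 2))))) ≤
      ENNReal.ofReal (Real.exp (-(2 * a ^ 2 / (N * b ^ 2)))) := by
    intro t ht
    rw [expect_mul_const]
    refine (mul_le_mul' (expect_sumSamples_le M μ hb t N) le_rfl).trans_eq ?_
    rw [← ENNReal.ofReal_pow (Real.exp_pos _).le, ← ENNReal.ofReal_mul (by positivity),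
      ← Real.exp_nat_mul, ← Real.exp_add, ht]
    congr 2
    field_simp
    ring
  rw [two_mul, ENNReal.ofReal_add (Real.exp_pos _).le (Real.exp_pos _).le]
  refine le_trans ?_ (add_le_add (key (4 * a / (N * b ^ 2)) rfl)
    (key (-(4 * a / (N * b ^ 2))) (neg_sq _)))
  rw [← expect_add]
  refine expect_mono M f _ fun s => ?_
  set x := s - N * ∑ B, (μ B).toReal * f B
  split_ifs with hs
  · exact zero_le
  · rw [not_le, lt_abs] at hs
    have hpos : 0 ≤ 4 * a / (N * b ^ 2) := by positivity
    have hmul : 4 * a / (N * b ^ 2) * a = 4 * a ^ 2 / (N * b ^ 2) := by ring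
    simp only [← ENNReal.ofReal_mul (Real.exp_pos _).le, ← Real.exp_add]
    rcases hs with hs | hs
    · refine le_trans ?_ le_self_add
      rw [ENNReal.one_le_ofReal, Real.one_le_exp_iff]
      nlinarith
    · refine le_trans ?_ le_add_self
      rw [ENNReal.one_le_ofReal, Real.one_le_exp_iff]
      nlinarith

/-- Covers `f(A) = 0`, where the range `[0, f(A)]` is degenerate and the Hoeffding bound with its
positive range is unavailable. -/
theorem failProb_sumSamples_eq_zero (M : Matroid U) {f : Finset U → ℝ} (μ : PMF (Finset U))
    (hf : ∀ B, μ B ≠ 0 → f B = 0) (N : ℕ) : failProb M f (sumSamples μ N) (fun s => s = 0) = 0 := by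
  induction N with
  | zero => simp [sumSamples, failProb, expect]
  | succ N ih =>
    simp only [failProb, sumSamples, expect, expect_bind, ENNReal.tsum_eq_zero, mul_eq_zero]
    intro B
    by_cases hB : μ B = 0
    · exact Or.inl hB
    · right
      simpa [hf B hB, failProb] using ih

/-! ### The sampling distribution and the accuracy of the estimator -/

theorem tsum_weightFun {c : ℝ} (hc : 0 < c) (A : Finset U) :
    ∑' B, weightFun c A B = ENNReal.ofReal (tau c A) := by
  classical
  rw [tsum_eq_sum (s := A.powerset), tau, ENNReal.ofReal_sum_of_nonneg
    fun B _ => weight_nonneg hc A B]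
  · exact Finset.sum_congr rfl fun B hB => by simp [weightFun, Finset.mem_powerset.1 hB]
  · intro B hB
    rw [weightFun, if_neg fun h => hB (Finset.mem_powerset.2 h)]

theorem nu_apply {c : ℝ} (hc : 0 < c) {A : Finset U} (hA : A.Nonempty) (B : Finset U) :
    nu c A B = weightFun c A B * (ENNReal.ofReal (tau c A))⁻¹ := by
  have h := tsum_weightFun hc A
  have h' : (∑' B, weightFun c A B) ≠ 0 ∧ (∑' B, weightFun c A B) ≠ ⊤ := by
    rw [h]
    exact ⟨(ENNReal.ofReal_pos.2 (tau_pos hc hA)).ne', ENNReal.ofReal_ne_top⟩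
  rw [nu, dif_pos h', PMF.normalize_apply, h]

theorem sum_nu_mul [Fintype U] {c : ℝ} (hc : 0 < c) {A : Finset U} (hA : A.Nonempty)
    (f : Finset U → ℝ) : ∑ B, (nu c A B).toReal * f B = potential c f A / tau c A := by
  classical
  rw [potential, Finset.sum_div, ← Finset.sum_subset (Finset.subset_univ A.powerset)]
  · refine Finset.sum_congr rfl fun B hB => ?_
    rw [nu_apply hc hA, weightFun, if_pos (Finset.mem_powerset.1 hB), ENNReal.toReal_mul,
      ENNReal.toReal_inv, ENNReal.toReal_ofReal (weight_nonneg hc A B),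
      ENNReal.toReal_ofReal (tau_pos hc hA).le]
    ring
  · intro B _ hB
    rw [nu_apply hc hA, weightFun, if_neg fun h => hB (Finset.mem_powerset.2 h)]
    simp

/-- The samples lie in `[0, f(A)]` and have mean `g(A)/τ(A)`. Tolerance `N δ g/τ` for their sum
gives the Hoeffding exponent `2N (δ/τ)² (g/f)²`. Since `g ≥ f` the last factor is at least `1`,
which is why the error can be relative to `g`. -/
theorem failProb_estimate_le [Fintype U] [DecidableEq U] (M : Matroid U) {f : Finset U → ℝ}
    (h0 : f ∅ = 0) (hf : Monotone f) (ha : AntitoneMarginals f) {c : ℝ} (hc : 0 < c)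
    {A : Finset U} (hA : A.Nonempty) {δ T L : ℝ} {N : ℕ} (hδ : 0 < δ) (hT : tau c A ≤ T)
    (hL : 0 < L) (hN : 1 / 2 * (T / δ) ^ 2 * L ≤ N) :
    failProb M f (estimate c N A) (fun y => |y - potential c f A| ≤ δ * potential c f A) ≤
      ENNReal.ofReal (2 * Real.exp (-L)) := by
  have hτ := tau_pos hc hA
  have hT0 : 0 < T := hτ.trans_le hT
  have hN' : (0 : ℝ) < N := lt_of_lt_of_le (by positivity) hN
  have hnn : ∀ B, 0 ≤ f B := fun B => h0 ▸ hf (Finset.empty_subset B)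
  have hg := le_potential hc h0 ha A
  have hg' := potential_le_tau_mul hc hf A
  have hsupp : ∀ B, nu c A B ≠ 0 → B ⊆ A := by
    intro B hB
    by_contra h
    exact hB (by rw [nu_apply hc hA, weightFun, if_neg h, zero_mul])
  rw [← add_zero (ENNReal.ofReal _)]
  rcases (hnn A).eq_or_lt with hA0 | hA0
  · rw [← hA0, mul_zero] at hg'
    have hg0 : potential c f A = 0 := le_antisymm hg' (hA0 ▸ hg)
    refine failProb_bind_le M f (Q := fun s => s = 0) ?_ fun s hs => ?_
    · rw [failProb_sumSamples_eq_zero]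
      · exact zero_le
      · exact fun B hB => le_antisymm (hA0 ▸ hf (hsupp B hB)) (hnn B)
    · exact failProb_ret M f (by simp [hs, hg0]) _
  · set g := potential c f A
    have hg0 : 0 < g := hA0.trans_le hg
    refine failProb_bind_le M f
      (Q := fun s => |s - N * ∑ B, (nu c A B).toReal * f B| ≤ N * δ * g / tau c A) ?_
      fun s hs => failProb_ret M f ?_ _
    · refine (failProb_sumSamples_le M (nu c A) hA0 (fun B hB => ⟨hnn B, hf (hsupp B hB)⟩)
        (by exact_mod_cast hN') (by positivity)).trans ?_
      refine ENNReal.ofReal_le_ofReal ?_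
      gcongr
      have e : 2 * (N * δ * g / tau c A) ^ 2 / (N * f A ^ 2) =
          2 * N * (δ / tau c A) ^ 2 * (g / f A) ^ 2 := by
        field_simp
      rw [e]
      have h1 : 1 ≤ (g / f A) ^ 2 := one_le_pow₀ ((one_le_div hA0).2 hg)
      have h2 : L ≤ 2 * N * (δ / tau c A) ^ 2 := by
        calc L = 2 * (1 / 2 * (T / δ) ^ 2 * L) * (δ / T) ^ 2 := by field_simp
          _ ≤ 2 * N * (δ / tau c A) ^ 2 := by gcongr
      calc L ≤ 2 * N * (δ / tau c A) ^ 2 := h2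
        _ ≤ _ := le_mul_of_one_le_right (by positivity) h1
    · rw [sum_nu_mul hc hA] at hs
      have e : tau c A * (1 / (N : ℝ)) * s - g =
          tau c A / N * (s - N * (g / tau c A)) := by
        field_simp
      rw [e, abs_mul, abs_of_pos (by positivity)]
      calc tau c A / N * |s - N * (g / tau c A)| ≤ tau c A / N * (N * δ * g / tau c A) := by gcongr
        _ = δ * g := by field_simp

end Concentration

/-! ### Correctness of the two phases, for accurate estimates -/

section Correctness

open OracleProg
open scoped ENNReal

theorem OracleProg.failProb_indep_of_indep {U : Type u} {β : Type v} {M : Matroid U}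
    (f : Finset U → ℝ) {A : Finset U} (hA : M.Indep (A : Set U)) (k : Bool → OracleProg U β)
    (P : β → Prop) : failProb M f (indep A k) P = failProb M f (k true) P := by
  simp [failProb, expect, hA]

theorem OracleProg.failProb_indep_of_not_indep {U : Type u} {β : Type v} {M : Matroid U}
    (f : Finset U → ℝ) {A : Finset U} (hA : ¬ M.Indep (A : Set U)) (k : Bool → OracleProg U β)
    (P : β → Prop) : failProb M f (indep A k) P = failProb M f (k false) P := by
  simp [failProb, expect, hA]

/-- The better one of the best candidate so far and a new candidate `x` of value `y`. -/
noncomputable def better {α : Type u} (best : Option (α × ℝ)) (x : α) (y : ℝ) : Option (α × ℝ) :=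
  match best with
  | none => some (x, y)
  | some (x', y') => if y' < y then some (x, y) else some (x', y')

theorem exists_better {α : Type u} (best : Option (α × ℝ)) (x : α) (y : ℝ) :
    ∃ b : α × ℝ, better best x y = some b ∧
      (b = (x, y) ∨ best = some b) ∧ y ≤ b.2 ∧ ∀ q, best = some q → q.2 ≤ b.2 := by
  rcases best with _ | ⟨x', y'⟩
  · exact ⟨(x, y), rfl, Or.inl rfl, le_rfl, by simp⟩
  · by_cases hlt : y' < y
    · refine ⟨(x, y), if_pos hlt, Or.inl rfl, le_rfl, fun q hq => ?_⟩
      obtain rfl := Option.some.inj hq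
      exact hlt.le
    · refine ⟨(x', y'), if_neg hlt, Or.inr rfl, not_lt.1 hlt, fun q hq => ?_⟩
      obtain rfl := Option.some.inj hq
      exact le_rfl

theorem greedyRound_cons {U : Type u} [DecidableEq U] (est : Finset U → OracleProg U ℝ)
    (S : Finset U) (x : U) (xs : List U) (best : Option (U × ℝ)) :
    greedyRound est S (x :: xs) best =
      if x ∈ S then greedyRound est S xs best
      else .indep (insert x S) fun b =>
        if b then (est (insert x S)).bind fun y => greedyRound est S xs (better best x y)
        else greedyRound est S xs best := by
  cases best <;> rfl

variable {U : Type u} [DecidableEq U] {M : Matroid U} {f g : Finset U → ℝ}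
  {est : Finset U → OracleProg U ℝ} {δ : ℝ} {η : ℝ≥0∞}

/-- `y` approximates `g A` with relative error `δ`. -/
def IsAccurate (g : Finset U → ℝ) (δ : ℝ) (A : Finset U) (y : ℝ) : Prop :=
  |y - g A| ≤ δ * g A

omit [DecidableEq U] in
theorem IsAccurate.le {A : Finset U} {y : ℝ} (h : IsAccurate g δ A y) : y ≤ (1 + δ) * g A := by
  have := (abs_le.1 h).2
  linarith

omit [DecidableEq U] in
theorem IsAccurate.ge {A : Finset U} {y : ℝ} (h : IsAccurate g δ A y) : (1 - δ) * g A ≤ y := by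
  have := (abs_le.1 h).1
  linarith

/-- `p` consists of an element by which `S` can be extended, and an accurate estimate of the value
of the extension. -/
def IsCandidate (M : Matroid U) (g : Finset U → ℝ) (δ : ℝ) (S : Finset U) (p : U × ℝ) : Prop :=
  p.1 ∉ S ∧ M.Indep (insert p.1 S : Finset U) ∧ IsAccurate g δ (insert p.1 S) p.2

/-- The middle clause serves the induction: the best estimate never decreases during the scan, so
each estimate seen stays a lower bound for the final one. -/
theorem failProb_greedyRound_le
    (hest : ∀ A : Finset U, A.Nonempty → failProb M f (est A) (IsAccurate g δ A) ≤ η)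
    (S : Finset U) (xs : List U) (best : Option (U × ℝ))
    (hbest : ∀ p, best = some p → IsCandidate M g δ S p) :
    failProb M f (greedyRound est S xs best) (fun o =>
      (∀ p, o = some p → IsCandidate M g δ S p) ∧
      (∀ q, best = some q → ∃ p, o = some p ∧ q.2 ≤ p.2) ∧
      ∀ x ∈ xs, x ∉ S → M.Indep (insert x S : Finset U) →
        ∃ p, o = some p ∧ (1 - δ) * g (insert x S) ≤ p.2) ≤ xs.length * η := by
  induction xs generalizing best with
  | nil => exact failProb_ret M f ⟨hbest, fun q hq => ⟨q, hq, le_rfl⟩, by simp⟩ _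
  | cons x xs ih =>
    have hlen : ((x :: xs).length : ℝ≥0∞) * η = η + xs.length * η := by
      push_cast [List.length_cons]
      ring
    rw [hlen, greedyRound_cons]
    by_cases hx : x ∈ S
    · rw [if_pos hx]
      refine (failProb_mono M f _ fun o ho => ?_).trans ((ih best hbest).trans le_add_self)
      refine ⟨ho.1, ho.2.1, fun y hy hyS => ?_⟩
      rcases List.mem_cons.1 hy with rfl | hy
      · exact absurd hx hyS
      · exact ho.2.2 y hy hyS
    · rw [if_neg hx]
      by_cases hi : M.Indep (insert x S : Finset U)
      · rw [failProb_indep_of_indep f hi, if_pos rfl]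
        refine failProb_bind_le M f (hest _ (Finset.insert_nonempty x S)) fun y hy => ?_
        have hcand : IsCandidate M g δ S (x, y) := ⟨hx, hi, hy⟩
        obtain ⟨b', hb', hb1, hb2, hb3⟩ := exists_better best x y
        have hb1 : IsCandidate M g δ S b' := hb1.elim (fun h => h ▸ hcand) fun h => hbest _ h
        rw [hb']
        refine (failProb_mono M f _ fun o ho => ?_).trans
          (ih (some b') fun p hp => Option.some.inj hp ▸ hb1)
        obtain ⟨p, hp, hbp⟩ := ho.2.1 b' rfl
        refine ⟨ho.1, fun q hq => ⟨p, hp, (hb3 q hq).trans hbp⟩, fun z hz hzS hzi => ?_⟩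
        rcases List.mem_cons.1 hz with rfl | hz
        · exact ⟨p, hp, hy.ge.trans (hb2.trans hbp)⟩
        · exact ho.2.2 z hz hzS hzi
      · rw [failProb_indep_of_not_indep f hi, if_neg Bool.false_ne_true]
        refine (failProb_mono M f _ fun o ho => ?_).trans ((ih best hbest).trans le_add_self)
        refine ⟨ho.1, ho.2.1, fun y hy hyS hyi => ?_⟩
        rcases List.mem_cons.1 hy with rfl | hy
        · exact absurd hyi hi
        · exact ho.2.2 y hy hyS hyi

/-- The invariant of the greedy algorithm after `k` rounds. -/
def GreedyInvariant (M : Matroid U) (g : Finset U → ℝ) (δ : ℝ) (k : ℕ) (S : Finset U) : Prop :=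
  M.Indep (S : Set U) ∧ S.card = k ∧ ∀ T O : Finset U, S ⊆ T → M.Indep (O : Set U) → O.card ≤ k →
    g (T ∪ O) - g T ≤ (1 + 3 * k * δ) * g S

/-- If `O` has `k + 1` elements, augmentation gives `o ∈ O` with `S + o` independent. Apply the
invariant to `O - o`; the marginal of `o` at `T ∪ (O - o)` is at most its marginal at `S`, and
near-maximality gives `g(S + o) ≤ (1 + 3δ) g(S + p)`. Letting `T` range over all supersets of `S`
lets the invariant pass to supersets of the extended solution. -/
theorem GreedyInvariant.insert (hg : Monotone g) (hg0 : g ∅ = 0) (ha : AntitoneMarginals g)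
    (hδ : 0 ≤ δ) (hδ' : δ ≤ 1 / 8) {k : ℕ} {S : Finset U} (hS : GreedyInvariant M g δ k S)
    {p : U × ℝ} (hp : IsCandidate M g δ S p)
    (hmax : ∀ x ∉ S, M.Indep (insert x S : Finset U) → (1 - δ) * g (insert x S) ≤ p.2) :
    GreedyInvariant M g δ (k + 1) (insert p.1 S) := by
  obtain ⟨hSi, hSc, hSg⟩ := hS
  refine ⟨hp.2.1, by rw [Finset.card_insert_of_notMem hp.1, hSc], fun T O hT hO hOk => ?_⟩
  have hST : S ⊆ T := (Finset.subset_insert _ _).trans hT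
  have hgS : 0 ≤ g S := hg0 ▸ hg (Finset.empty_subset S)
  have hgx : g S ≤ g (Insert.insert p.1 S) := hg (Finset.subset_insert _ _)
  have hk : (0 : ℝ) ≤ k * δ := by positivity
  push_cast
  rcases Nat.lt_or_ge k O.card with hlt | hle
  · obtain ⟨o, hoO, hoS, hoi⟩ := exists_insert_indep hSi hO (hSc.trans_lt hlt)
    have h1 := hSg T (O.erase o) hST (hO.subset (by simp))
      (by rw [Finset.card_erase_of_mem hoO]; omega)
    have h2 := ha (hST.trans (Finset.subset_union_left (s₂ := O.erase o))) o
    rw [← Finset.union_insert, Finset.insert_erase hoO] at h2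
    have h3 := (hmax o hoS hoi).trans hp.2.2.le
    have h4 : g (Insert.insert o S) ≤ (1 + 3 * δ) * g (Insert.insert p.1 S) := by
      -- `1 + δ ≤ (1 - δ)(1 + 3δ)` holds for `0 ≤ δ ≤ 1/3`.
      have h5 : (1 + δ) * g (Insert.insert p.1 S) ≤
          (1 - δ) * ((1 + 3 * δ) * g (Insert.insert p.1 S)) := by
        rw [← mul_assoc]
        exact mul_le_mul_of_nonneg_right (by nlinarith) (hgS.trans hgx)
      exact le_of_mul_le_mul_left (h3.trans h5) (by linarith)
    nlinarith [mul_le_mul_of_nonneg_left hgx hk]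
  · have h1 := hSg T O hST hO hle
    nlinarith [mul_le_mul_of_nonneg_left hgx hk, mul_nonneg hδ (hgS.trans hgx)]

theorem failProb_greedy_le
    (hest : ∀ A : Finset U, A.Nonempty → failProb M f (est A) (IsAccurate g δ A) ≤ η)
    (hg : Monotone g) (hg0 : g ∅ = 0) (ha : AntitoneMarginals g)
    (hδ : 0 ≤ δ) (hδ' : δ ≤ 1 / 8) {B : Finset U} (hB : M.Indep (B : Set U)) {elems : List U}
    (helems : ∀ x, x ∈ elems) (j k : ℕ) (hjk : k + j ≤ B.card) {S : Finset U}
    (hS : GreedyInvariant M g δ k S) :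
    failProb M f (greedy est elems j S) (GreedyInvariant M g δ (k + j)) ≤
      j * (elems.length * η) := by
  induction j generalizing k S with
  | zero => exact failProb_ret M f hS _
  | succ j ih =>
    have : ((j + 1 : ℕ) : ℝ≥0∞) * (elems.length * η) =
        elems.length * η + j * (elems.length * η) := by
      push_cast
      ring
    rw [this, greedy]
    refine failProb_bind_le M f (failProb_greedyRound_le hest S elems none (by simp)) ?_
    rintro o ⟨ho1, -, ho3⟩
    -- Greedy cannot get stuck: `S` is smaller than the independent set `B`.
    obtain ⟨x, -, hxS, hxi⟩ := exists_insert_indep hS.1 hB (by rw [hS.2.1]; omega)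
    obtain ⟨p, rfl, -⟩ := ho3 x (helems x) hxS hxi
    rw [show k + (j + 1) = k + 1 + j by omega]
    refine ih (k + 1) (by omega) (hS.insert hg hg0 ha hδ hδ' (ho1 p rfl) fun x hxS hxi => ?_)
    obtain ⟨p', hp', h⟩ := ho3 x (helems x) hxS hxi
    obtain rfl := Option.some.inj hp'
    exact h

/-! ### The local search phase -/

theorem failProb_findExchange_le
    (hest : ∀ A : Finset U, A.Nonempty → failProb M f (est A) (IsAccurate g δ A) ≤ η)
    (S : Finset U) (v : ℝ) (ps : List (U × U)) :
    failProb M f (findExchange est δ S v ps) (fun o =>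
      (o = none → ∀ p ∈ ps, M.Indep (insert p.2 (S.erase p.1) : Finset U) →
        (1 - δ) * g (insert p.2 (S.erase p.1)) ≤ (1 + δ) * v) ∧
      ∀ q, o = some q → M.Indep (q.1 : Set U) ∧ IsAccurate g δ q.1 q.2 ∧ (1 + δ) * v < q.2 ∧
        ∃ p ∈ ps, q.1 = insert p.2 (S.erase p.1)) ≤ ps.length * η := by
  induction ps with
  | nil => exact failProb_ret M f ⟨by simp, by simp⟩ _
  | cons p ps ih =>
    obtain ⟨e, x⟩ := p
    have hlen : (((e, x) :: ps).length : ℝ≥0∞) * η = η + ps.length * η := by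
      push_cast [List.length_cons]
      ring
    rw [hlen, findExchange]
    by_cases hi : M.Indep (insert x (S.erase e) : Finset U)
    · rw [failProb_indep_of_indep f hi, if_pos rfl]
      refine failProb_bind_le M f (hest _ (Finset.insert_nonempty _ _)) fun y hy => ?_
      split_ifs with hv
      · refine failProb_ret M f ⟨by simp, fun q hq => ?_⟩ _
        obtain rfl := Option.some.inj hq
        exact ⟨hi, hy, hv, (e, x), by simp, rfl⟩
      · refine (failProb_mono M f _ fun o ho => ⟨fun hn p hp hpi => ?_, fun q hq => ?_⟩).trans ih
        · rcases List.mem_cons.1 hp with rfl | hp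
          · exact hy.ge.trans (not_lt.1 hv)
          · exact ho.1 hn p hp hpi
        · obtain ⟨h1, h2, h3, p, hp, h4⟩ := ho.2 q hq
          exact ⟨h1, h2, h3, p, List.mem_cons_of_mem _ hp, h4⟩
    · rw [failProb_indep_of_not_indep f hi, if_neg Bool.false_ne_true]
      refine (failProb_mono M f _ fun o ho => ⟨fun hn p hp hpi => ?_, fun q hq => ?_⟩).trans
        (ih.trans le_add_self)
      · rcases List.mem_cons.1 hp with rfl | hp
        · exact absurd hpi hi
        · exact ho.1 hn p hp hpi
      · obtain ⟨h1, h2, h3, p, hp, h4⟩ := ho.2 q hq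
        exact ⟨h1, h2, h3, p, List.mem_cons_of_mem _ hp, h4⟩

/-- The number of pairs which are considered in an iteration of the local search. -/
theorem length_exchangePairs_le {elems : List U} (hnd : elems.Nodup) (S : Finset U) :
    ((elems.filter fun e => decide (e ∈ S)) ×ˢ
      (elems.filter fun x => decide (x ∉ S))).length ≤ S.card * elems.length := by
  rw [List.length_product]
  refine Nat.mul_le_mul ?_ (List.length_filter_le _ _)
  rw [← List.toFinset_card_of_nodup (hnd.filter _)]
  refine Finset.card_le_card fun x hx => ?_
  simpa using (List.mem_filter.1 (List.mem_toFinset.1 hx)).2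

/-- `S` is an approximate local optimum of `g` among the sets which arise by an exchange. -/
def IsLocalOptimum (M : Matroid U) (g : Finset U → ℝ) (δ : ℝ) (S : Finset U) : Prop :=
  ∀ e ∈ S, ∀ x ∉ S, M.Indep (insert x (S.erase e) : Finset U) →
    (1 - δ) * g (insert x (S.erase e)) ≤ (1 + δ) ^ 2 * g S

/-- `hk` is a budget: with `k` iterations left, no independent set has `(1 + δ) g` above `(1 + δ)^k
v`. A replacement raises `v` by a factor above `1 + δ`, which pays for lowering `k`. At `k = 0` the
budget alone gives only `(1 + δ) g(S) ≤ v`; the strict clause, supplied by the last replacement,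
contradicts the accuracy of `v`. -/
theorem failProb_localSearch_le
    (hest : ∀ A : Finset U, A.Nonempty → failProb M f (est A) (IsAccurate g δ A) ≤ η)
    (hδ : 0 ≤ δ) {elems : List U} (hnd : elems.Nodup) (helems : ∀ x, x ∈ elems) {r : ℕ}
    (k : ℕ) {S : Finset U} {v : ℝ} (hS : M.Indep (S : Set U)) (hSr : S.card = r)
    (hv : IsAccurate g δ S v)
    (hk : (∀ A : Finset U, M.Indep (A : Set U) → (1 + δ) * g A ≤ (1 + δ) ^ k * v) ∧
      (k = 0 → (1 + δ) * g S < v)) :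
    failProb M f (localSearch est elems δ k S v) (fun o => ∃ S', o = some S' ∧
      M.Indep (S' : Set U) ∧ S'.card = r ∧ IsLocalOptimum M g δ S') ≤
      k * ((r * elems.length : ℕ) * η) := by
  induction k generalizing S v with
  | zero => exact absurd (hk.2 rfl) (not_lt.2 hv.le)
  | succ k ih =>
    have : ((k + 1 : ℕ) : ℝ≥0∞) * ((r * elems.length : ℕ) * η) =
        (r * elems.length : ℕ) * η + k * ((r * elems.length : ℕ) * η) := by
      push_cast
      ring
    rw [this, localSearch]
    refine failProb_bind_le M f ((failProb_findExchange_le hest S v _).trans ?_) ?_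
    · rw [← hSr]
      gcongr
      exact length_exchangePairs_le hnd S
    · rintro o ⟨ho1, ho2⟩
      rcases o with _ | ⟨S', v'⟩
      · refine failProb_ret M f ⟨S, rfl, hS, hSr, fun e he x hx hi => ?_⟩ _
        have h := ho1 rfl (e, x) (by simp [he, hx, helems]) hi
        have h' := mul_le_mul_of_nonneg_left hv.le (show 0 ≤ 1 + δ by linarith)
        nlinarith
      · obtain ⟨hi, hacc, hlt, ⟨e, x⟩, hp, hS'⟩ := ho2 (S', v') rfl
        simp only [List.mem_product, List.mem_filter, decide_eq_true_eq] at hp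
        simp only at hi hacc hlt hS'
        refine ih hi ?_ hacc ⟨fun A hA => (hk.1 A hA).trans ?_, ?_⟩
        · rw [hS', Finset.card_insert_of_notMem (fun h => hp.2.2 (Finset.mem_of_mem_erase h)),
            Finset.card_erase_add_one hp.1.2, hSr]
        · rw [pow_succ, mul_assoc]
          exact mul_le_mul_of_nonneg_left hlt.le (pow_nonneg (by linarith) _)
        · rintro rfl
          have := hk.1 S' hi
          rw [zero_add, pow_one] at this
          linarith

end Correctness

/-! ### Worst case behaviour of the algorithms -/

section WorstCase

open OracleProg
open scoped ENNReal

theorem OracleProg.Runs.indep {U : Type u} {β : Type v} {M : Matroid U} {f : Finset U → ℝ}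
    {P : β → Prop} {A : Finset U} {k : Bool → OracleProg U β} {t : ℕ}
    (h1 : M.Indep (A : Set U) → Runs M f P (k true) t)
    (h2 : ¬ M.Indep (A : Set U) → Runs M f P (k false) t) :
    Runs M f P (indep A k) (1 + t) := by
  refine ⟨t, by omega, ?_⟩
  by_cases hA : M.Indep (A : Set U)
  · simpa [hA] using h1 hA
  · simpa [hA] using h2 hA

theorem runs_sumSamples {U : Type u} (M : Matroid U) (f : Finset U → ℝ) (μ : PMF (Finset U))
    (N : ℕ) : Runs M f (fun _ => True) (sumSamples μ N) (2 * N) := by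
  induction N with
  | zero => trivial
  | succ N ih =>
    exact ⟨2 * N + 1, by omega, fun B => ⟨2 * N, by omega,
      Runs.bind (t := 0) ih fun _ _ => trivial⟩⟩

theorem runs_estimate {U : Type u} (M : Matroid U) (f : Finset U → ℝ) (c : ℝ) (N : ℕ)
    (A : Finset U) : Runs M f (fun _ => True) (estimate c N A) (2 * N) :=
  Runs.bind (t := 0) (runs_sumSamples M f _ N) fun _ _ => trivial

variable {U : Type u} [DecidableEq U] {M : Matroid U} {f : Finset U → ℝ}
  {est : Finset U → OracleProg U ℝ} {t : ℕ}

theorem runs_greedyRound (hest : ∀ A, Runs M f (fun _ => True) (est A) t) (S : Finset U)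
    (xs : List U) (best : Option (U × ℝ))
    (hbest : ∀ p, best = some p → p.1 ∉ S ∧ M.Indep (insert p.1 S : Finset U)) :
    Runs M f (fun o => ∀ p, o = some p → p.1 ∉ S ∧ M.Indep (insert p.1 S : Finset U))
      (greedyRound est S xs best) (xs.length * (1 + t)) := by
  induction xs generalizing best with
  | nil => exact hbest
  | cons x xs ih =>
    have hlen : (x :: xs).length * (1 + t) = 1 + (t + xs.length * (1 + t)) := by
      rw [List.length_cons]
      ring
    rw [hlen, greedyRound_cons]
    split_ifs with hx
    · exact (ih best hbest).mono (by omega)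
    · refine Runs.indep (fun hi => ?_) fun hi => (ih best hbest).mono (by omega)
      rw [if_pos rfl]
      refine (hest _).bind fun y _ => ih _ fun p hp => ?_
      obtain ⟨b, hb, hb1, -⟩ := exists_better best x y
      obtain rfl := Option.some.inj (Eq.trans hb.symm hp)
      rcases hb1 with rfl | hb1
      · exact ⟨hx, hi⟩
      · exact hbest _ hb1

theorem runs_greedy (hest : ∀ A, Runs M f (fun _ => True) (est A) t) (elems : List U) (j : ℕ)
    {S : Finset U} (hS : M.Indep (S : Set U)) :
    Runs M f (fun S' : Finset U => M.Indep (S' : Set U) ∧ S'.card ≤ S.card + j) (greedy est elems j S)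
      (j * (elems.length * (1 + t))) := by
  induction j generalizing S with
  | zero => exact ⟨hS, le_rfl⟩
  | succ j ih =>
    have hj : (j + 1) * (elems.length * (1 + t)) =
        elems.length * (1 + t) + j * (elems.length * (1 + t)) := by ring
    rw [hj, greedy]
    refine (runs_greedyRound hest S elems none (by simp)).bind fun o ho => ?_
    rcases o with _ | p
    · exact ⟨hS, by omega⟩
    · have h := ih (ho p rfl).2
      rw [Finset.card_insert_of_notMem (ho p rfl).1] at h
      rw [show S.card + (j + 1) = S.card + 1 + j by ring]
      exact h

theorem runs_findExchange (hest : ∀ A, Runs M f (fun _ => True) (est A) t) (δ : ℝ)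
    (S : Finset U) (v : ℝ) (ps : List (U × U)) :
    Runs M f (fun o => ∀ q, o = some q → M.Indep (q.1 : Set U) ∧
      ∃ p ∈ ps, q.1 = insert p.2 (S.erase p.1)) (findExchange est δ S v ps)
      (ps.length * (1 + t)) := by
  -- The list in the postcondition is held fixed while the scanned list shrinks in the induction.
  suffices h : ∀ qs : List (U × U), (∀ p ∈ ps, p ∈ qs) →
      Runs M f (fun o => ∀ q, o = some q → M.Indep (q.1 : Set U) ∧
        ∃ p ∈ qs, q.1 = insert p.2 (S.erase p.1)) (findExchange est δ S v ps)
        (ps.length * (1 + t)) from h ps fun _ h => h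
  intro qs hqs
  induction ps with
  | nil => exact fun q hq => by simp at hq
  | cons p ps ih =>
    obtain ⟨e, x⟩ := p
    have ih := ih fun p hp => hqs p (List.mem_cons_of_mem _ hp)
    have hlen : ((e, x) :: ps).length * (1 + t) = 1 + (t + ps.length * (1 + t)) := by
      rw [List.length_cons]
      ring
    rw [hlen, findExchange]
    refine Runs.indep (fun hi => ?_) fun hi => ih.mono (by omega)
    rw [if_pos rfl]
    refine (hest _).bind fun y _ => ?_
    split_ifs with hv
    · intro q hq
      obtain rfl := Option.some.inj hq
      exact ⟨hi, (e, x), hqs _ List.mem_cons_self, rfl⟩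
    · exact ih

theorem runs_localSearch (hest : ∀ A, Runs M f (fun _ => True) (est A) t) (δ : ℝ)
    {elems : List U} (hnd : elems.Nodup) {r : ℕ} (k : ℕ) {S : Finset U} (v : ℝ)
    (hS : M.Indep (S : Set U)) (hSr : S.card ≤ r) :
    Runs M f (fun o => ∀ S' : Finset U, o = some S' → M.Indep (S' : Set U)) (localSearch est elems δ k S v)
      (k * (r * elems.length * (1 + t))) := by
  induction k generalizing S v with
  | zero => exact fun S' h => by simp at h
  | succ k ih =>
    have hk : (k + 1) * (r * elems.length * (1 + t)) =
        r * elems.length * (1 + t) + k * (r * elems.length * (1 + t)) := by ring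
    rw [hk, localSearch]
    refine ((runs_findExchange hest δ S v _).mono (Nat.mul_le_mul_right _
      ((length_exchangePairs_le hnd S).trans (Nat.mul_le_mul_right _ hSr)))).bind fun o ho => ?_
    rcases o with _ | ⟨S', v'⟩
    · intro S' h
      exact Option.some.inj h ▸ hS
    · obtain ⟨hi, ⟨e, x⟩, hp, hS'⟩ := ho (S', v') rfl
      simp only [List.mem_product, List.mem_filter, decide_eq_true_eq] at hp hS'
      refine ih v' hi (le_trans ?_ hSr)
      rw [hS', Finset.card_insert_of_notMem (fun h => hp.2.2 (Finset.mem_of_mem_erase h)),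
        Finset.card_erase_add_one hp.1.2]

/-- A bound for the running time of the local search algorithm with `N` samples per evaluation and
at most `I` iterations. -/
def searchTime (n r N I : ℕ) : ℕ :=
  r * (n * (1 + 2 * N)) + (2 * N + I * (r * n * (1 + 2 * N)))

theorem runs_localSearchAlg (M : Matroid U) (f : Finset U → ℝ) {elems : List U}
    (hnd : elems.Nodup) (r : ℕ) (c ε α : ℝ) :
    Runs M f (fun o => ∀ S' : Finset U, o = some S' → M.Indep (S' : Set U)) (localSearchAlg elems r c ε α)
      (searchTime elems.length r (samples elems.length r c ε α) (iterations r ε)) := by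
  have hest := runs_estimate M f c (samples elems.length r c ε α)
  refine (runs_greedy hest elems r (S := ∅) (by simp)).bind fun S hS =>
    (hest S).bind fun v _ => runs_localSearch hest _ hnd _ v hS.1 ?_
  simpa using hS.2

theorem tryGuesses_cons (elems : List U) (r : ℕ) (ε α c : ℝ) (cs : List ℝ)
    (best : Option (Finset U × ℝ)) :
    tryGuesses elems r ε α (c :: cs) best =
      (localSearchAlg elems r c (ε / 2) α).bind fun o =>
        match o with
        | none => tryGuesses elems r ε α cs best
        | some S => .value S fun y => tryGuesses elems r ε α cs (better best S y) := by
  cases best <;> rfl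

theorem runs_tryGuesses {elems : List U} {r : ℕ} {ε α : ℝ} {T : ℕ} (cs : List ℝ)
    (hcs : ∀ c ∈ cs, Runs M f (fun o => ∀ S' : Finset U, o = some S' → M.Indep (S' : Set U))
      (localSearchAlg elems r c (ε / 2) α) T) (best : Option (Finset U × ℝ))
    (hbest : ∀ p, best = some p → M.Indep (p.1 : Set U) ∧ p.2 = f p.1) :
    Runs M f (fun o => ∀ p, best = some p → ∃ S : Finset U, o = some S ∧ M.Indep (S : Set U) ∧ p.2 ≤ f S)
      (tryGuesses elems r ε α cs best) (cs.length * (T + 1)) := by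
  induction cs generalizing best with
  | nil =>
    rintro p rfl
    exact ⟨p.1, rfl, (hbest p rfl).1, (hbest p rfl).2.le⟩
  | cons c cs ih =>
    have ih := ih fun c hc => hcs c (List.mem_cons_of_mem _ hc)
    rw [List.length_cons, add_mul, one_mul, add_comm, add_assoc, tryGuesses_cons]
    refine (hcs c List.mem_cons_self).bind fun o ho => ?_
    rcases o with _ | S
    · exact (ih best hbest).mono (by omega)
    · refine ⟨cs.length * (T + 1), by omega, ?_⟩
      obtain ⟨b, hb, hb1, hb2, hb3⟩ := exists_better best S (f S)
      have hb4 : M.Indep (b.1 : Set U) ∧ b.2 = f b.1 := by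
        rcases hb1 with rfl | hb1
        · exact ⟨ho S rfl, rfl⟩
        · exact hbest b hb1
      refine Runs.imp (Q := fun o => ∀ p, best = some p →
        ∃ S : Finset U, o = some S ∧ M.Indep (S : Set U) ∧ p.2 ≤ f S)
        (ih _ fun p hp => Option.some.inj (Eq.trans hb.symm hp) ▸ hb4) fun o ho p hp => ?_
      obtain ⟨S', h1, h2, h3⟩ := ho b hb
      exact ⟨S', h1, h2, (hb3 p hp).trans h3⟩

/-- No union bound over the guesses is needed: other runs return independent sets or errors surely,
and after the run for `c₀` the incumbent's value never decreases. -/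
theorem failProb_tryGuesses_le {elems : List U} {r : ℕ} {ε α q : ℝ} {T : ℕ} {a : ℝ≥0∞}
    (cs : List ℝ)
    (hcs : ∀ c ∈ cs, Runs M f (fun o => ∀ S' : Finset U, o = some S' → M.Indep (S' : Set U))
      (localSearchAlg elems r c (ε / 2) α) T) {c₀ : ℝ} (hc₀ : c₀ ∈ cs)
    (ha : failProb M f (localSearchAlg elems r c₀ (ε / 2) α)
      (fun o => ∃ S, o = some S ∧ IsApproxSolution M f q S) ≤ a)
    (best : Option (Finset U × ℝ))
    (hbest : ∀ p, best = some p → M.Indep (p.1 : Set U) ∧ p.2 = f p.1) :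
    failProb M f (tryGuesses elems r ε α cs best)
      (fun o => ∃ S, o = some S ∧ IsApproxSolution M f q S) ≤ a := by
  induction cs generalizing best with
  | nil => simp at hc₀
  | cons c cs ih =>
    have hcs' := fun c hc => hcs c (List.mem_cons_of_mem _ hc)
    have hnext : ∀ (S : Finset U) (b : Finset U × ℝ), M.Indep (S : Set U) →
        (b = (S, f S) ∨ best = some b) → M.Indep (b.1 : Set U) ∧ b.2 = f b.1 := by
      rintro S b hS (rfl | hb)
      · exact ⟨hS, rfl⟩
      · exact hbest b hb
    rw [tryGuesses_cons]
    by_cases hc : c₀ = c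
    · subst hc
      rw [← add_zero a]
      refine failProb_bind_le M f ha ?_
      rintro _ ⟨S, rfl, hS⟩
      obtain ⟨b, hb, hb1, hb2, -⟩ := exists_better best S (f S)
      have hb1 := hnext S b hS.1 hb1
      refine (Runs.imp (Q := fun o => ∃ S, o = some S ∧ IsApproxSolution M f q S)
        (runs_tryGuesses cs hcs' _ fun p hp => Option.some.inj (Eq.trans hb.symm hp) ▸ hb1)
        fun o ho => ?_).failProb_le 0
      obtain ⟨S', h1, h2, h3⟩ := ho b hb
      exact ⟨S', h1, h2, fun O hO => (hS.2 O hO).trans (hb2.trans h3)⟩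
    · have hc₀' : c₀ ∈ cs := (List.mem_cons.1 hc₀).resolve_left hc
      rw [← zero_add a]
      refine failProb_bind_le M f ((hcs c List.mem_cons_self).failProb_le 0) fun o ho => ?_
      rcases o with _ | S
      · exact ih hcs' hc₀' best hbest
      · obtain ⟨b, hb, hb1, -⟩ := exists_better best S (f S)
        have hb1 := hnext S b (ho S rfl) hb1
        exact ih hcs' hc₀' _ fun p hp => Option.some.inj (Eq.trans hb.symm hp) ▸ hb1

end WorstCase

/-! ### The parameters of the algorithm -/

section Parameters

theorem harmonic_mono : Monotone harmonic :=
  monotone_nat_of_le_succ fun n => by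
    rw [harmonic_succ]
    exact le_add_of_nonneg_right (by positivity)

theorem one_le_harmonic {r : ℕ} (hr : 1 ≤ r) : (1 : ℝ) ≤ (harmonic r : ℝ) := by
  have h := harmonic_mono hr
  have h1 : harmonic 1 = 1 := by simp [harmonic]
  rw [h1] at h
  exact_mod_cast h

/-! ### The approximation ratio and the density at `1` -/

theorem rho_eq {c : ℝ} (hc : 0 < c) : rho c = (density c 1)⁻¹ := by
  have h := (exp_sub_one_pos hc).ne'
  rw [rho, if_neg hc.ne', density, mul_one, Real.exp_neg]
  have := Real.exp_pos c
  field_simp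

theorem one_le_density_one {c : ℝ} (hc : 0 < c) : 1 ≤ density c 1 := by
  rw [density, mul_one, one_le_div (exp_sub_one_pos hc)]
  have h := Real.add_one_le_exp (-c)
  have h2 : Real.exp (-c) * Real.exp c = 1 := by rw [← Real.exp_add]; simp
  nlinarith [Real.exp_pos c]

theorem density_one_le {c : ℝ} (hc : 0 < c) (hc1 : c ≤ 1) : density c 1 ≤ 3 := by
  rw [density, mul_one, div_le_iff₀ (exp_sub_one_pos hc)]
  have h := Real.add_one_le_exp c
  have h1 : Real.exp c ≤ 3 := by
    have := Real.exp_le_exp.2 hc1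
    have := Real.exp_one_lt_d9
    linarith
  nlinarith

/-- `ρ(t) = ∫₀¹ e^{-ts} ds`. Between `c` and `c'` the integrand drops by at most `(c' - c) s ≤ ε s`,
and `∫₀¹ ε s ds = ε/2`. -/
theorem rho_le_add {c c' ε : ℝ} (hc : 0 ≤ c) (hcc : c ≤ c') (hc' : c' ≤ c + ε) :
    rho c ≤ rho c' + ε / 2 := by
  have key : ∀ t : ℝ, rho t = ∫ s in (0 : ℝ)..1, Real.exp (-(t * s)) := by
    intro t
    by_cases ht : t = 0
    · simp [ht, rho]
    · have h : ∀ s ∈ Set.uIcc (0 : ℝ) 1,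
          HasDerivAt (fun s => -(t⁻¹ * Real.exp (-(t * s)))) (Real.exp (-(t * s))) s := by
        intro s _
        have h1 : HasDerivAt (fun s => -(t * s)) (-t) s := by
          simpa using ((hasDerivAt_id s).const_mul t).fun_neg
        refine HasDerivAt.congr_deriv (h1.exp.const_mul t⁻¹).fun_neg ?_
        field_simp
      rw [intervalIntegral.integral_eq_sub_of_hasDerivAt h
        (Continuous.intervalIntegrable (by fun_prop) _ _), rho, if_neg ht]
      simp
      field_simp
      ring
  have h1 : rho c - rho c' ≤ ∫ s in (0 : ℝ)..1, ε * s := by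
    rw [key, key, ← intervalIntegral.integral_sub
      (Continuous.intervalIntegrable (by fun_prop) _ _)
      (Continuous.intervalIntegrable (by fun_prop) _ _)]
    refine intervalIntegral.integral_mono_on zero_le_one
      (Continuous.intervalIntegrable (by fun_prop) _ _)
      (Continuous.intervalIntegrable (by fun_prop) _ _) fun s hs => ?_
    have e : Real.exp (-(c' * s)) = Real.exp (-(c * s)) * Real.exp (-((c' - c) * s)) := by
      rw [← Real.exp_add]
      congr 1
      ring
    have h2 := Real.add_one_le_exp (-((c' - c) * s))
    have h3 : Real.exp (-(c * s)) ≤ 1 := Real.exp_le_one_iff.2 (by nlinarith [hs.1])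
    have h4 := Real.exp_pos (-(c * s))
    have h5 : 0 ≤ (c' - c) * s := mul_nonneg (by linarith) hs.1
    have h6 : (c' - c) * s ≤ ε * s := mul_le_mul_of_nonneg_right (by linarith) hs.1
    rw [e]
    nlinarith
  have h2 : ∫ s in (0 : ℝ)..1, ε * s = ε / 2 := by
    rw [intervalIntegral.integral_const_mul, integral_id]
    ring
  linarith

variable {r : ℕ} {ε : ℝ}

theorem stepParam_pos (hr : 1 ≤ r) (hε : 0 < ε) : 0 < stepParam r ε := by
  have := one_le_harmonic hr
  have : (1 : ℝ) ≤ r := by exact_mod_cast hr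
  unfold stepParam
  positivity

theorem stepParam_mul (hr : 1 ≤ r) : 4 * r * (harmonic r : ℝ) * stepParam r ε = ε := by
  have := one_le_harmonic hr
  have : (1 : ℝ) ≤ r := by exact_mod_cast hr
  unfold stepParam
  field_simp

theorem mul_stepParam_le (hr : 1 ≤ r) (hε : 0 < ε) (hε' : ε ≤ 1 / 2) :
    r * stepParam r ε ≤ 1 / 8 := by
  have h1 := one_le_harmonic hr
  have h2 := stepParam_pos hr hε
  have h3 := stepParam_mul (ε := ε) hr
  have : (1 : ℝ) ≤ r := by exact_mod_cast hr
  nlinarith [mul_le_mul_of_nonneg_left h1 (show 0 ≤ r * stepParam r ε by positivity)]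

theorem stepParam_le (hr : 1 ≤ r) (hε : 0 < ε) (hε' : ε ≤ 1 / 2) : stepParam r ε ≤ 1 / 8 := by
  have h1 := mul_stepParam_le hr hε hε'
  have h2 := stepParam_pos hr hε
  have : (1 : ℝ) ≤ r := by exact_mod_cast hr
  nlinarith

theorem two_le_ratio (hr : 1 ≤ r) (hε : 0 < ε) (hε' : ε ≤ 1 / 2) :
    2 ≤ (1 + stepParam r ε) / (1 - stepParam r ε) * (2 + 3 * (r : ℝ) * stepParam r ε) := by
  have h1 := stepParam_le hr hε hε'
  have h2 := stepParam_pos hr hε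
  have h3 : 1 ≤ (1 + stepParam r ε) / (1 - stepParam r ε) := by
    rw [one_le_div] <;> linarith
  have h4 : 0 ≤ 3 * (r : ℝ) * stepParam r ε := by positivity
  nlinarith

theorem iterations_pos (hr : 1 ≤ r) (hε : 0 < ε) (hε' : ε ≤ 1 / 2) : 0 < iterations r ε := by
  rw [iterations, Nat.ceil_pos]
  have h1 := two_le_ratio hr hε hε'
  have h2 := stepParam_pos hr hε
  exact mul_pos (by linarith) (inv_pos.2 h2)

/-- Bernoulli's inequality `(1 + δ)^I ≥ 1 + I δ`, which explains the form of `I`; this is the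
initial budget of the local search. -/
theorem ratio_le_pow_iterations (hr : 1 ≤ r) (hε : 0 < ε) (hε' : ε ≤ 1 / 2) :
    (1 + stepParam r ε) / (1 - stepParam r ε) * (2 + 3 * (r : ℝ) * stepParam r ε) ≤
      (1 + stepParam r ε) ^ iterations r ε := by
  have h2 := stepParam_pos hr hε
  have h := Nat.le_ceil (((1 + stepParam r ε) / (1 - stepParam r ε) *
    (2 + 3 * (r : ℝ) * stepParam r ε) - 1) * (stepParam r ε)⁻¹)
  change _ ≤ (iterations r ε : ℝ) at h
  rw [← div_eq_mul_inv, div_le_iff₀ h2] at h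
  have h3 := one_add_mul_le_pow (a := stepParam r ε) (by linarith) (iterations r ε)
  linarith

end Parameters

/-! ### The guarantee of the local search algorithm -/

section Guarantee

open OracleProg
open scoped ENNReal

variable {U : Type u} [Fintype U] [DecidableEq U] {M : Matroid U} {f : Finset U → ℝ}

/-- Extend `O` to a base and sum the `r` exchanges: `f(O) ≤ D f(S) + 4 r δ g(S)`. With `g(S) ≤ D H_r
f(S)` and `4 r H_r δ = ε`, the error term is `ε D f(S)`. -/
theorem IsLocalOptimum.isApproxSolution {r : ℕ} (hrank : M.eRank = (r : ℕ∞)) (hr : 1 ≤ r)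
    (h0 : f ∅ = 0) (hf : Monotone f) (ha : AntitoneMarginals f) {c : ℝ} (hc : 0 < c)
    (hc1 : c ≤ 1) (hcurv : HasCurvature f c) {ε : ℝ} (hε : 0 < ε) (hε' : ε ≤ 1 / 2)
    {S : Finset U} (hS : M.Indep (S : Set U)) (hSr : S.card = r)
    (hopt : IsLocalOptimum M (potential c f) (stepParam r ε) S) :
    IsApproxSolution M f (rho c - ε) S := by
  refine ⟨hS, fun O hO => ?_⟩
  obtain ⟨B, hOB, hB, hBr⟩ := exists_base_superset hrank hO
  obtain ⟨π, hπ, hπ'⟩ := exists_exchange_bijOn (isBase_of_card_eq hrank hS hSr) hB.indep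
    (hBr.trans hSr.symm)
  have hmain := sum_potential_sub_le hc hc1 h0 ha hcurv hπ fun o ho => (hπ' o ho).1
  set g := potential c f
  set δ := stepParam r ε
  have hδ : 0 < δ := stepParam_pos hr hε
  have hδ' : δ ≤ 1 / 8 := stepParam_le hr hε hε'
  have hnn : ∀ A, 0 ≤ f A := fun A => h0 ▸ hf (Finset.empty_subset A)
  have hgS : 0 ≤ g S := (hnn S).trans (le_potential hc h0 ha S)
  have hterm : ∀ o ∈ B, -(4 * δ * g S) ≤ g S - g (insert o (S.erase (π o))) := by
    intro o ho
    have hπo : π o ∈ S := hπ.mapsTo ho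
    by_cases hoS : o ∈ S
    · have : π o = o := by
        by_contra hne
        exact (hπ' o ho).1 (Finset.mem_erase.2 ⟨fun h => hne h.symm, hoS⟩)
      rw [this, Finset.insert_erase hoS, sub_self, neg_nonpos]
      positivity
    · have h1 := hopt (π o) hπo o hoS (hπ' o ho).2
      -- `(1 + δ)² ≤ (1 - δ)(1 + 4δ)` holds for `0 ≤ δ ≤ 1/5`.
      have h2 : (1 + δ) ^ 2 * g S ≤ (1 - δ) * ((1 + 4 * δ) * g S) := by
        rw [← mul_assoc]
        exact mul_le_mul_of_nonneg_right (by nlinarith) hgS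
      have h3 := le_of_mul_le_mul_left (h1.trans h2) (by linarith)
      linarith
  have hsum := Finset.card_nsmul_le_sum B _ _ hterm
  rw [hBr, nsmul_eq_mul] at hsum
  have hτ : g S ≤ density c 1 * (harmonic r : ℝ) * f S := by
    refine (potential_le_tau_mul hc hf S).trans (mul_le_mul_of_nonneg_right ?_ (hnn S))
    rw [← hSr]
    exact tau_le hc S
  have hD := one_le_density_one hc
  set D := density c 1
  have hDf : f O ≤ (1 + ε) * (D * f S) := by
    have h1 := mul_le_mul_of_nonneg_left hτ (show 0 ≤ 4 * r * δ by positivity)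
    have h2 : 4 * r * δ * (D * (harmonic r : ℝ) * f S) = ε * (D * f S) := by
      rw [← stepParam_mul (ε := ε) hr]
      ring
    have h3 := hf hOB
    rw [h2] at h1
    linarith
  rw [rho_eq hc]
  rcases le_total (D⁻¹ - ε) 0 with h | h
  -- A nonpositive ratio makes the claim trivial, as `f` is nonnegative.
  · nlinarith [hnn O, hnn S]
  · calc (D⁻¹ - ε) * f O ≤ (D⁻¹ - ε) * ((1 + ε) * (D * f S)) := by gcongr
      _ = (1 - ε * D) * (1 + ε) * f S := by field_simp
      _ ≤ 1 * f S := by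
        refine mul_le_mul_of_nonneg_right ?_ (hnn S)
        have h1 : ε ≤ ε * D := le_mul_of_one_le_right hε.le hD
        nlinarith
      _ = f S := one_mul _

theorem failProb_localSearchAlg_le {r : ℕ} (hrank : M.eRank = (r : ℕ∞)) (hr : 1 ≤ r)
    {elems : List U} (hnd : elems.Nodup) (helems : ∀ x, x ∈ elems)
    (h0 : f ∅ = 0) (hf : Monotone f) (ha : AntitoneMarginals f) {c : ℝ} (hc : 0 < c)
    (hc1 : c ≤ 1) (hcurv : HasCurvature f c) {ε α : ℝ} (hε : 0 < ε) (hε' : ε ≤ 1 / 2)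
    (hα : 0 < α) :
    failProb M f (localSearchAlg elems r c ε α)
      (fun o => ∃ S, o = some S ∧ IsApproxSolution M f (rho c - ε) S) ≤
      ENNReal.ofReal (4 * (elems.length : ℝ) ^ (-α)) := by
  have hI := iterations_pos hr hε hε'
  have hpow := ratio_le_pow_iterations hr hε hε'
  have hδ := stepParam_pos hr hε
  have hδ' := stepParam_le hr hε hε'
  have hcard : ∀ A : Finset U, A.card ≤ elems.length := fun A => by
    rw [← List.toFinset_card_of_nodup hnd]
    exact Finset.card_le_card fun x _ => List.mem_toFinset.2 (helems x)
  obtain ⟨B, -, hB, hBr⟩ := exists_base_superset hrank (A := ∅) (by simp)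
  have hn : r ≤ elems.length := hBr ▸ hcard B
  set n := elems.length
  set N := samples n r c ε α with hN
  set I := iterations r ε
  set δ := stepParam r ε
  have hr' : (1 : ℝ) ≤ r := by exact_mod_cast hr
  have hn' : (1 : ℝ) ≤ n := by exact_mod_cast hr.trans hn
  have hI' : (1 : ℝ) ≤ I := by exact_mod_cast hI
  have hnα : (1 : ℝ) ≤ (n : ℝ) ^ (1 + α) := Real.one_le_rpow hn' (by linarith)
  set X : ℝ := ((I : ℝ) + 1) * r * (n : ℝ) ^ (1 + α)
  have hX : 2 ≤ X := by
    have h1 : 2 ≤ ((I : ℝ) + 1) * r := by nlinarith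
    exact h1.trans (le_mul_of_one_le_right (by linarith) hnα)
  set η : ℝ≥0∞ := ENNReal.ofReal (2 * Real.exp (-Real.log X)) with hη
  have hest : ∀ A : Finset U, A.Nonempty →
      failProb M f (estimate c N A) (IsAccurate (potential c f) δ A) ≤ η := by
    intro A hA
    refine failProb_estimate_le M h0 hf ha hc hA (T := density c 1 * (harmonic n : ℝ)) hδ
      ((tau_le hc A).trans ?_) (Real.log_pos (by linarith)) ?_
    · refine mul_le_mul_of_nonneg_left ?_ (density_pos hc 1).le
      exact_mod_cast harmonic_mono (hcard A)
    · refine le_trans (le_of_eq ?_) (Nat.le_ceil _)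
      rw [density, mul_one, mul_div_assoc]
  have hg := potential_monotone hc h0 hf
  have hg0 := potential_empty c f
  have hga := potential_antitoneMarginals hc h0 hf ha
  have hprob : failProb M f (localSearchAlg elems r c ε α)
      (fun o => ∃ S, o = some S ∧ IsApproxSolution M f (rho c - ε) S) ≤
      r * (n * η) + (η + I * ((r * n : ℕ) * η)) := by
    refine failProb_bind_le M f (Q := GreedyInvariant M (potential c f) δ r) ?_ fun S hS => ?_
    · have h := failProb_greedy_le hest hg hg0 hga hδ.le hδ' hB.indep helems r 0 (by omega)
        (S := ∅) ⟨by simp, rfl, fun T O _ _ hO => ?_⟩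
      · rwa [zero_add] at h
      · rw [Finset.card_eq_zero.1 (Nat.le_zero.1 hO), hg0]
        simp
    · refine failProb_bind_le M f (hest S ?_) fun v hv => ?_
      · rw [← Finset.card_pos, hS.2.1]
        exact hr
      · refine (failProb_mono M f _ ?_).trans (failProb_localSearch_le hest hδ.le hnd helems I hS.1
          hS.2.1 hv ⟨fun A hA => ?_, fun h => absurd h hI.ne'⟩)
        · rintro o ⟨S', ho, hS', hS'r, hopt⟩
          exact ⟨S', ho, hopt.isApproxSolution hrank hr h0 hf ha hc hc1 hcurv hε hε' hS' hS'r⟩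
        · have h1 := hS.2.2 S A subset_rfl hA (card_le_of_indep hrank hA)
          have h2 := hg (Finset.subset_union_right : A ⊆ S ∪ A)
          have h3 : potential c f A ≤ (2 + 3 * r * δ) * potential c f S := by linarith
          have h4 : (0 : ℝ) < 1 - δ := by linarith
          have hv0 : 0 ≤ v := le_trans (mul_nonneg h4.le (hg0 ▸ hg (Finset.empty_subset S))) hv.ge
          calc (1 + δ) * potential c f A ≤ (1 + δ) * ((2 + 3 * r * δ) * potential c f S) := by gcongr
            _ = (1 + δ) / (1 - δ) * (2 + 3 * r * δ) * ((1 - δ) * potential c f S) := by field_simp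
            _ ≤ (1 + δ) / (1 - δ) * (2 + 3 * r * δ) * v := by
              gcongr
              exact hv.ge
            _ ≤ (1 + δ) ^ I * v := by gcongr
  refine hprob.trans ?_
  have e : (r : ℝ≥0∞) * (n * η) + (η + I * ((r * n : ℕ) * η)) =
      ((r * n + 1 + I * (r * n) : ℕ) : ℝ≥0∞) * η := by
    push_cast
    ring
  rw [e, hη, ← ENNReal.ofReal_natCast, ← ENNReal.ofReal_mul (by positivity)]
  refine ENNReal.ofReal_le_ofReal ?_
  rw [Real.exp_neg, Real.exp_log (by linarith)]
  -- At most `r n` evaluations in greedy, one of its result and `I r n` in the search. Each fails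
  -- with probability at most `2/X`, and `X = (I + 1) r n · n^α`.
  have h1 : ((r * n + 1 + I * (r * n) : ℕ) : ℝ) ≤ 2 * ((I + 1) * r * n) := by
    have : 1 ≤ (r : ℝ) * n := by nlinarith
    have : 0 ≤ (I : ℝ) * (r * n) := by positivity
    push_cast
    nlinarith
  have hn0 : (0 : ℝ) < n := by linarith
  have h2 : X⁻¹ = (((I : ℝ) + 1) * r * n)⁻¹ * (n : ℝ) ^ (-α) := by
    rw [Real.rpow_neg hn0.le, ← mul_inv]
    congr 1
    simp only [X]
    rw [Real.rpow_add hn0, Real.rpow_one]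
    ring
  calc ((r * n + 1 + I * (r * n) : ℕ) : ℝ) * (2 * X⁻¹)
      ≤ 2 * ((I + 1) * r * n) * (2 * X⁻¹) := by
        gcongr
    _ = 4 * (n : ℝ) ^ (-α) := by
        rw [h2]
        field_simp
        ring

/-! ### The guesses -/

theorem guesses_pos_le_one {ε : ℝ} (hε : 0 < ε) {c : ℝ} (hc : c ∈ guesses ε) : 0 < c ∧ c ≤ 1 := by
  simp only [guesses, Finset.mem_union, Finset.mem_image, Finset.mem_Icc, Finset.mem_singleton]
    at hc
  rcases hc with ⟨k, ⟨hk1, hk2⟩, rfl⟩ | rfl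
  · have h1 : (1 : ℝ) ≤ k := by exact_mod_cast hk1
    have h2 : (k : ℝ) ≤ ε⁻¹ := (Nat.le_floor_iff (by positivity)).1 hk2
    refine ⟨by positivity, ?_⟩
    calc (k : ℝ) * ε ≤ ε⁻¹ * ε := by gcongr
      _ = 1 := by field_simp
  · exact ⟨one_pos, le_rfl⟩

theorem card_guesses_le {ε : ℝ} (hε : 0 < ε) (hε1 : ε ≤ 1) :
    ((guesses ε).card : ℝ) ≤ 2 * ε⁻¹ := by
  have h1 : (guesses ε).card ≤ ⌊ε⁻¹⌋₊ + 1 := by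
    refine (Finset.card_union_le _ _).trans ?_
    have := Finset.card_image_le (s := Finset.Icc 1 ⌊ε⁻¹⌋₊) (f := fun k : ℕ => (k : ℝ) * ε)
    simpa using this
  have h2 : (⌊ε⁻¹⌋₊ : ℝ) ≤ ε⁻¹ := Nat.floor_le (by positivity)
  have h3 : 1 ≤ ε⁻¹ := (one_le_inv₀ hε).2 hε1
  have h4 : ((guesses ε).card : ℝ) ≤ ⌊ε⁻¹⌋₊ + 1 := by exact_mod_cast h1
  linarith

/-- Round `c` up to the next multiple of `ε` strictly above it, so that `c = 0` also gets a positive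
guess. If that multiple exceeds `1`, then `1 < c + ε` and the guess `1` serves. -/
theorem exists_guess {ε : ℝ} (hε : 0 < ε) {c : ℝ} (hc0 : 0 ≤ c) (hc1 : c ≤ 1) :
    ∃ c' ∈ guesses ε, c ≤ c' ∧ c' ≤ c + ε := by
  have hk := Nat.lt_floor_add_one (c / ε)
  rw [div_lt_iff₀ hε] at hk
  have hk' : (⌊c / ε⌋₊ : ℝ) * ε ≤ c := by
    rw [← le_div_iff₀ hε]
    exact Nat.floor_le (by positivity)
  by_cases h : ((⌊c / ε⌋₊ + 1 : ℕ) : ℝ) * ε ≤ 1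
  · refine ⟨((⌊c / ε⌋₊ + 1 : ℕ) : ℝ) * ε, Finset.mem_union_left _ (Finset.mem_image.2
      ⟨_, Finset.mem_Icc.2 ⟨Nat.le_add_left _ _, Nat.le_floor ?_⟩, rfl⟩), ?_, ?_⟩
    · rwa [← one_div, le_div_iff₀ hε]
    · push_cast
      exact hk.le
    · push_cast
      linarith
  · refine ⟨1, Finset.mem_union_right _ (Finset.mem_singleton_self _), hc1, ?_⟩
    push_cast at h
    linarith

end Guarantee

/-! ### The running time -/

section RunningTime

variable {n r : ℕ} {ε : ℝ}

theorem log_two_le_log (hn : 1 ≤ n) (hε : 0 < ε) (hε1 : ε ≤ 1) :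
    Real.log 2 ≤ Real.log (2 * n / ε) := by
  have hn' : (1 : ℝ) ≤ n := by exact_mod_cast hn
  refine Real.log_le_log (by norm_num) ?_
  rw [le_div_iff₀ hε]
  nlinarith

theorem log_le_log_div (hn : 1 ≤ n) (hε : 0 < ε) (hε1 : ε ≤ 1) :
    Real.log n ≤ Real.log (2 * n / ε) := by
  have hn' : (1 : ℝ) ≤ n := by exact_mod_cast hn
  refine Real.log_le_log (by linarith) ?_
  rw [le_div_iff₀ hε]
  nlinarith

theorem log_inv_le_log_div (hn : 1 ≤ n) (hε : 0 < ε) :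
    Real.log ε⁻¹ ≤ Real.log (2 * n / ε) := by
  have hn' : (1 : ℝ) ≤ n := by exact_mod_cast hn
  refine Real.log_le_log (by positivity) ?_
  rw [div_eq_mul_inv]
  exact le_mul_of_one_le_left (by positivity) (by linarith)

/-- The logarithm may be below `1`, but it is at least `log 2 > 1/2`; the factor `2` lets additive
constants be absorbed. -/
theorem one_le_two_mul_log (hn : 1 ≤ n) (hε : 0 < ε) (hε1 : ε ≤ 1) :
    1 ≤ 2 * Real.log (2 * n / ε) := by
  have h1 := log_two_le_log hn hε hε1
  have h2 := Real.log_two_gt_d9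
  linarith

theorem harmonic_le_log (hn : 1 ≤ n) (hε : 0 < ε) (hε1 : ε ≤ 1) :
    (harmonic n : ℝ) ≤ 3 * Real.log (2 * n / ε) := by
  have h1 := harmonic_le_one_add_log n
  have h2 := one_le_two_mul_log hn hε hε1
  have h3 := log_le_log_div hn hε hε1
  linarith

theorem inv_stepParam_le (hr : 1 ≤ r) (hrn : r ≤ n) (hε : 0 < ε) (hε1 : ε ≤ 1) :
    (stepParam r (ε / 2))⁻¹ ≤ 24 * (r * Real.log (2 * n / ε) * ε⁻¹) := by
  have h1 : (harmonic r : ℝ) ≤ harmonic n := by exact_mod_cast harmonic_mono hrn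
  have h2 := h1.trans (harmonic_le_log (hr.trans hrn) hε hε1)
  have e : (stepParam r (ε / 2))⁻¹ = 8 * r * ε⁻¹ * harmonic r := by
    unfold stepParam
    field_simp
    ring
  rw [e]
  calc 8 * r * ε⁻¹ * (harmonic r : ℝ) ≤ 8 * r * ε⁻¹ * (3 * Real.log (2 * n / ε)) := by gcongr
    _ = _ := by ring

theorem one_le_mul_log (hr : 1 ≤ r) (hrn : r ≤ n) (hε : 0 < ε) (hε1 : ε ≤ 1) :
    1 ≤ 2 * (r * Real.log (2 * n / ε) * ε⁻¹) := by
  have h1 := one_le_two_mul_log (hr.trans hrn) hε hε1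
  have h2 : 1 ≤ ε⁻¹ := (one_le_inv₀ hε).2 hε1
  have h3 : (1 : ℝ) ≤ r := by exact_mod_cast hr
  have h4 : 1 ≤ (r : ℝ) * ε⁻¹ := one_le_mul_of_one_le_of_one_le h3 h2
  calc (1 : ℝ) ≤ (r * ε⁻¹) * (2 * Real.log (2 * n / ε)) := one_le_mul_of_one_le_of_one_le h4 h1
    _ = _ := by ring

/-- The ratio is at most `4`, so `I + 2 ≤ 3/δ + 3`, and `78 = 3 · 24 + 3 · 2`. -/
theorem iterations_le (hr : 1 ≤ r) (hrn : r ≤ n) (hε : 0 < ε) (hε1 : ε ≤ 1) :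
    (iterations r (ε / 2) : ℝ) + 2 ≤ 78 * (r * Real.log (2 * n / ε) * ε⁻¹) := by
  have h1 := stepParam_le hr (half_pos hε) (by linarith)
  have h2 := mul_stepParam_le hr (half_pos hε) (by linarith)
  have h3 := stepParam_pos hr (half_pos hε)
  have h4 := two_le_ratio hr (half_pos hε) (by linarith)
  have h5 := inv_stepParam_le hr hrn hε hε1
  have h6 := one_le_mul_log hr hrn hε hε1
  set δ := stepParam r (ε / 2) with hδ
  have h7 : (1 + δ) / (1 - δ) * (2 + 3 * (r : ℝ) * δ) ≤ 4 := by
    have h8 : (1 + δ) / (1 - δ) ≤ 9 / 7 := by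
      rw [div_le_iff₀ (by linarith)]
      linarith
    calc (1 + δ) / (1 - δ) * (2 + 3 * (r : ℝ) * δ) ≤ 9 / 7 * (2 + 3 * (1 / 8)) := by
          have : 3 * (r : ℝ) * δ ≤ 3 * (1 / 8) := by linarith
          gcongr
      _ ≤ 4 := by norm_num
  have h9 := (Nat.ceil_lt_add_one (a := ((1 + δ) / (1 - δ) * (2 + 3 * (r : ℝ) * δ) - 1) * δ⁻¹)
    (mul_nonneg (by linarith) (inv_nonneg.2 h3.le))).le
  change (iterations r (ε / 2) : ℝ) ≤ _ at h9
  have h10 : ((1 + δ) / (1 - δ) * (2 + 3 * (r : ℝ) * δ) - 1) * δ⁻¹ ≤ 3 * δ⁻¹ :=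
    mul_le_mul_of_nonneg_right (by linarith) (inv_nonneg.2 h3.le)
  linarith

/-- `13 = 10 + 1 + 2`, from the factors `I + 1`, `r` and `n^{1+α}`; the logarithm inside the bound
for `I` is absorbed by `log l ≤ l - 1`. -/
theorem log_union_le (hr : 1 ≤ r) (hrn : r ≤ n) (hε : 0 < ε) (hε1 : ε ≤ 1) (α : ℝ) :
    Real.log (((iterations r (ε / 2) : ℝ) + 1) * r * (n : ℝ) ^ (1 + α)) ≤
      13 * max α 1 * Real.log (2 * n / ε) := by
  have hn := hr.trans hrn
  have hr' : (1 : ℝ) ≤ r := by exact_mod_cast hr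
  have hn' : (1 : ℝ) ≤ n := by exact_mod_cast hn
  have h1 := iterations_le hr hrn hε hε1
  have h2 := log_two_le_log hn hε hε1
  have h3 := log_le_log_div hn hε hε1
  have h4 := log_inv_le_log_div hn hε
  have h5 := one_le_two_mul_log hn hε hε1
  have h6 : Real.log r ≤ Real.log n := Real.log_le_log (by linarith) (by exact_mod_cast hrn)
  set l := Real.log (2 * n / ε)
  have hl : 0 < l := by linarith
  have hI : (0 : ℝ) < (iterations r (ε / 2) : ℝ) + 1 := by positivity
  have h7 : Real.log ((iterations r (ε / 2) : ℝ) + 1) ≤ 10 * l := by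
    have h8 : (iterations r (ε / 2) : ℝ) + 1 ≤ 2 ^ 7 * r * l * ε⁻¹ := by
      have : 0 ≤ r * l * ε⁻¹ := by positivity
      nlinarith
    refine (Real.log_le_log hI h8).trans ?_
    have hε' : ε⁻¹ ≠ 0 := by positivity
    rw [Real.log_mul (by positivity) hε', Real.log_mul (by positivity) hl.ne',
      Real.log_mul (by positivity) (by positivity), Real.log_pow]
    have h9 := Real.log_le_sub_one_of_pos hl
    push_cast
    linarith
  rw [Real.log_mul (by positivity) (by positivity), Real.log_mul hI.ne' (by positivity),
    Real.log_rpow (by linarith)]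
  have h10 : (1 + α) * Real.log n ≤ 2 * max α 1 * l := by
    have h11 : 1 + α ≤ 2 * max α 1 := by
      have := le_max_left α 1
      have := le_max_right α 1
      linarith
    have : 0 ≤ Real.log n := Real.log_nonneg hn'
    have : 0 ≤ 2 * max α 1 := by positivity
    exact mul_le_mul h11 h3 (by assumption) (by assumption)
  nlinarith [le_max_right α 1]

/-- Of the five logarithmic factors, two come from `H_n²`, two from `ε₂⁻²` and one from the union
bound. -/
theorem samples_le (hr : 1 ≤ r) (hrn : r ≤ n) {c : ℝ} (hc : 0 < c) (hc1 : c ≤ 1) (hε : 0 < ε)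
    (hε1 : ε ≤ 1) (α : ℝ) :
    1 + 2 * (samples n r c (ε / 2) α : ℝ) ≤
      10 ^ 6 * ((r : ℝ) ^ 2 * Real.log (2 * n / ε) ^ 5 * ε⁻¹ ^ 2 * max α 1) := by
  have hn := hr.trans hrn
  have hr' : (1 : ℝ) ≤ r := by exact_mod_cast hr
  have hn' : (1 : ℝ) ≤ n := by exact_mod_cast hn
  have hlog := log_union_le hr hrn hε hε1 α
  have hδ := inv_stepParam_le hr hrn hε hε1
  have hδ0 := stepParam_pos hr (half_pos hε)
  have hH := harmonic_le_log hn hε hε1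
  have hH0 := one_le_harmonic hn
  have hl := one_le_two_mul_log hn hε hε1
  have hD := density_one_le hc hc1
  have hD0 := density_pos hc 1
  have hε' : 1 ≤ ε⁻¹ := (one_le_inv₀ hε).2 hε1
  have hm := le_max_right α 1
  have hceil := Nat.ceil_lt_add_one (a := 1 / 2 * (c * Real.exp c / (Real.exp c - 1) *
    ((harmonic n : ℝ) / stepParam r (ε / 2))) ^ 2 *
    Real.log (((iterations r (ε / 2) : ℝ) + 1) * (r : ℝ) * (n : ℝ) ^ (1 + α)))
  rw [show c * Real.exp c / (Real.exp c - 1) = density c 1 by rw [density, mul_one]] at hceil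
  set l := Real.log (2 * n / ε)
  set m := max α 1
  set D := density c 1
  set δ := stepParam r (ε / 2)
  set X := Real.log (((iterations r (ε / 2) : ℝ) + 1) * (r : ℝ) * (n : ℝ) ^ (1 + α))
  have hl0 : 0 < l := by linarith
  have hm0 : 0 < m := by linarith
  have h1 : D * ((harmonic n : ℝ) / δ) ≤ 3 * (3 * l * (24 * (r * l * ε⁻¹))) := by
    rw [div_eq_mul_inv]
    gcongr
  have h2 : 1 / 2 * (D * ((harmonic n : ℝ) / δ)) ^ 2 * X ≤
      1 / 2 * (3 * (3 * l * (24 * (r * l * ε⁻¹)))) ^ 2 * (13 * m * l) := by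
    have : 0 ≤ D * ((harmonic n : ℝ) / δ) := by positivity
    refine (mul_le_mul_of_nonneg_left hlog (by positivity)).trans ?_
    gcongr
  have h3 : (samples n r c (ε / 2) α : ℝ) ≤
      1 / 2 * (3 * (3 * l * (24 * (r * l * ε⁻¹)))) ^ 2 * (13 * m * l) + 1 := by
    rw [samples, show c * Real.exp c / (Real.exp c - 1) = D by simp only [D, density, mul_one]]
    rcases le_total 0 (1 / 2 * (D * ((harmonic n : ℝ) / δ)) ^ 2 * X) with h | h
    · linarith [hceil h]
    · rw [Nat.ceil_eq_zero.2 h]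
      push_cast
      positivity
  have h4 : 1 ≤ 32 * ((r : ℝ) ^ 2 * l ^ 5 * ε⁻¹ ^ 2 * m) := by
    have h5 : 1 ≤ (2 * l) ^ 5 := one_le_pow₀ hl
    calc (1 : ℝ) = 1 ^ 2 * 1 * 1 ^ 2 * 1 := by norm_num
      _ ≤ (r : ℝ) ^ 2 * (2 * l) ^ 5 * ε⁻¹ ^ 2 * m := by gcongr
      _ = _ := by ring
  have h6 : 1 / 2 * (3 * (3 * l * (24 * (r * l * ε⁻¹)))) ^ 2 * (13 * m * l) =
      303264 * ((r : ℝ) ^ 2 * l ^ 5 * ε⁻¹ ^ 2 * m) := by ring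
  rw [h6] at h3
  linarith

/-- The `- 1` leaves room for the value query that follows each run in `tryGuesses`. -/
theorem searchTime_le (hr : 1 ≤ r) (hrn : r ≤ n) {c : ℝ} (hc : 0 < c) (hc1 : c ≤ 1)
    (hε : 0 < ε) (hε1 : ε ≤ 1) (α : ℝ) :
    (searchTime n r (samples n r c (ε / 2) α) (iterations r (ε / 2)) : ℝ) ≤
      10 ^ 8 * ((r : ℝ) ^ 4 * n * ε⁻¹ ^ 3 * max α 1) * Real.log (2 * n / ε) ^ 6 - 1 := by
  have hn := hr.trans hrn
  have hr' : (1 : ℝ) ≤ r := by exact_mod_cast hr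
  have hn' : (1 : ℝ) ≤ n := by exact_mod_cast hn
  have hI := iterations_le hr hrn hε hε1
  have hN := samples_le hr hrn hc hc1 hε hε1 α
  have hl := one_le_two_mul_log hn hε hε1
  have hε' : 1 ≤ ε⁻¹ := (one_le_inv₀ hε).2 hε1
  have hm := le_max_right α 1
  set I : ℝ := (iterations r (ε / 2) : ℝ)
  set N : ℝ := (samples n r c (ε / 2) α : ℝ)
  have hI0 : 0 ≤ I := Nat.cast_nonneg _
  have hN0 : 0 ≤ N := Nat.cast_nonneg _
  set l := Real.log (2 * n / ε)
  set m := max α 1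
  have hl0 : 0 < l := by linarith
  have hm0 : 0 < m := by linarith
  have h1 : (searchTime n r (samples n r c (ε / 2) α) (iterations r (ε / 2)) : ℝ) ≤
      (I + 2) * (r * n) * (1 + 2 * N) := by
    have h2 : (1 : ℝ) ≤ r * n := one_le_mul_of_one_le_of_one_le hr' hn'
    have h3 : 1 * (1 + 2 * N) ≤ (r * n) * (1 + 2 * N) := by gcongr
    simp only [searchTime]
    push_cast
    change r * (n * (1 + 2 * N)) + (2 * N + I * (r * n * (1 + 2 * N))) ≤ _
    nlinarith
  have h4 : (I + 2) * (r * n) * (1 + 2 * N) ≤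
      78 * (r * l * ε⁻¹) * (r * n) * (10 ^ 6 * ((r : ℝ) ^ 2 * l ^ 5 * ε⁻¹ ^ 2 * m)) := by
    gcongr
  have h5 : 1 ≤ 64 * ((r : ℝ) ^ 4 * n * ε⁻¹ ^ 3 * m * l ^ 6) := by
    have h6 : 1 ≤ (2 * l) ^ 6 := one_le_pow₀ hl
    calc (1 : ℝ) = 1 ^ 4 * 1 * 1 ^ 3 * 1 * 1 := by norm_num
      _ ≤ (r : ℝ) ^ 4 * n * ε⁻¹ ^ 3 * m * (2 * l) ^ 6 := by gcongr
      _ = _ := by ring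
  nlinarith

end RunningTime

end NonObliviousSearch

theorem theorem7p3 :
    ∃ (K D : ℝ) (d : ℕ),
      ∀ (U : Type*) [Fintype U] [DecidableEq U] (M : Matroid U) (f : Finset U → ℝ)
        (elems : List U) (r : ℕ) (c ε α : ℝ),
        -- the instance: a matroid on `U` of rank `r ≥ 1`, a listing of `U`, and the objective `f`
        M.E = Set.univ → M.eRank = (r : ℕ∞) → 1 ≤ r →
        elems.Nodup → (∀ x : U, x ∈ elems) →
        f ∅ = 0 → Monotone f → IsSubmodular f →
        0 ≤ c → c ≤ 1 → HasCurvature f c →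
        0 < ε → ε ≤ 1 → 0 < α →
        -- every run takes time `Õ(r⁴ n ε⁻⁴ α)`
        (∀ z ∈ ((unknownCurvatureAlg elems r ε α).run M f).support,
          (z.2 : ℝ) ≤ K * ((r : ℝ) ^ 4 * (Fintype.card U : ℝ) * (ε⁻¹) ^ 4 * max α 1) *
            Real.log (2 * (Fintype.card U : ℝ) / ε) ^ d) ∧
        -- the output is a `(ρ(c) - ε)`-approximate solution with probability `1 - O(n^{-α})`
        1 - D * (Fintype.card U : ℝ) ^ (-α) ≤
          (((unknownCurvatureAlg elems r ε α).run M f).toOuterMeasure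
            {z | ∃ S : Finset U, z.1 = some S ∧ IsApproxSolution M f (rho c - ε) S}).toReal := by
  -- At most `2/ε` guesses at a cost of `10 ^ 8` each, up to the common factors; `4` is the constant
  -- of the union bound.
  refine ⟨2 * 10 ^ 8, 4, 6, ?_⟩
  intro U _ _ M f elems r c ε α _ hrank hr hnd helems h0 hf hsub hc0 hc1 hcurv hε hε1 hα
  have hcard : Fintype.card U = elems.length := by
    rw [← List.toFinset_card_of_nodup hnd, ← Finset.card_univ]
    congr 1
    ext x
    simp [helems x]
  obtain ⟨B, -, -, hBr⟩ := exists_base_superset hrank (A := ∅) (by simp)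
  have hrn : r ≤ elems.length := hcard ▸ hBr ▸ B.card_le_univ
  have hl := one_le_two_mul_log (hr.trans hrn) hε hε1
  rw [hcard]
  set n := elems.length with hn
  set W : ℝ := 10 ^ 8 * ((r : ℝ) ^ 4 * n * ε⁻¹ ^ 3 * max α 1) * Real.log (2 * n / ε) ^ 6 with hW
  have hruns : ∀ c' ∈ (guesses ε).sort (· ≤ ·),
      OracleProg.Runs M f (fun o => ∀ S' : Finset U, o = some S' → M.Indep (S' : Set U))
        (localSearchAlg elems r c' (ε / 2) α) ⌊W - 1⌋₊ := by
    intro c' hc'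
    have h := guesses_pos_le_one hε ((Finset.mem_sort _).1 hc')
    exact (runs_localSearchAlg M f hnd r c' (ε / 2) α).mono
      (Nat.le_floor (searchTime_le hr hrn h.1 h.2 hε hε1 α))
  refine ⟨fun z hz => ?_, ?_⟩
  · have h1 := (runs_tryGuesses _ hruns none (by simp)).time_le hz
    rw [Finset.length_sort] at h1
    have h2 : (z.2 : ℝ) ≤ (guesses ε).card * ((⌊W - 1⌋₊ : ℝ) + 1) := by exact_mod_cast h1
    have hW1 : 0 ≤ W - 1 := by
      have := (Nat.cast_nonneg _).trans (searchTime_le hr hrn one_pos le_rfl hε hε1 α)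
      exact this
    have h3 := Nat.floor_le hW1
    calc (z.2 : ℝ) ≤ (guesses ε).card * ((⌊W - 1⌋₊ : ℝ) + 1) := h2
      _ ≤ 2 * ε⁻¹ * W := by
        refine mul_le_mul (card_guesses_le hε hε1) (by linarith) (by positivity) (by positivity)
      _ = _ := by
        rw [hW]
        ring
  · obtain ⟨c', hc', hcc, hcε⟩ := exists_guess hε hc0 hc1
    have h := guesses_pos_le_one hε hc'
    have ha := hsub.antitoneMarginals hf
    refine OracleProg.run_toOuterMeasure_toReal M f _ (by positivity)
      (failProb_tryGuesses_le _ hruns ((Finset.mem_sort _).2 hc') ?_ none (by simp))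
    refine (OracleProg.failProb_mono M f _ ?_).trans (failProb_localSearchAlg_le hrank hr hnd
      helems h0 hf ha h.1 h.2 (hcurv.mono hcc hf h0) (half_pos hε) (by linarith) hα)
    rintro o ⟨S, ho, hS⟩
    refine ⟨S, ho, hS.1, fun O hO => le_trans ?_ (hS.2 O hO)⟩
    have hfO : 0 ≤ f O := h0 ▸ hf (Finset.empty_subset O)
    -- Half of `ε` pays for rounding the curvature, half for the error of the local search.
    exact mul_le_mul_of_nonneg_right (by linarith [rho_le_add hc0 hcc hcε]) hfO
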